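/- For a finite group $K$ let $R_{\mathbb C}(K)$ be its ring of virtual complex characters, with augmentation $\varepsilon$ (the degree) and operations $\lambda^n$ extending exterior powers by $\lambda_t(u+v)=\lambda_t(u)\lambda_t(v)$. Put $\gamma^n(u)=\lambda^n(u+n-1)$, and let $\Gamma^n(K)$ be the subgroup generated by the monomials $\gamma^{n_1}(u_1)\cdots\gamma^{n_k}(u_k)$ with $\varepsilon(u_i)=0$ and $\sum_i n_i\ge n$. Let $R^*_{\mathbb C}(K)=\bigoplus_{n\ge 0}\Gamma^n(K)/\Gamma^{n+1}(K)$, and for a representation $\tau$ let $c_1(\tau)$ be the class of $\gamma^1(\tau-\varepsilon(\tau))$ in $\Gamma^1(K)/\Gamma^2(K)$. For a subgroup $H\le K$ let $\mathcal N_H^K$ be tensor induction from $H$ to $K$, extended to virtual characters as follows. For a representation $\tau$ of $H$, let $\chi(\tau)$ be the $K$-equivariant bundle on the set of subsets $C\subseteq K/H$ with fibre $\bigotimes_{c\in C}(c\otimes\tau)$ at $C$. For virtual bundles $a,b$ on this set, let $(a\vee b)_C=\bigoplus_{C=C_1\sqcup C_2}a_{C_1}\otimes b_{C_2}$. Then $\mathcal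 N_H^K(\sigma-\tau)=\bigl(\chi(\sigma)\vee\chi(\tau)^{-1}\bigr)_{K/H}$, where the inverse is taken for $\vee$. Let $p$ be a prime, $G$ a finite abelian group, and $C_p$ a cyclic group of order $p$. Regard $G$ as the subgroup $G\times 1$ of $G\times C_p$. Then for every $n\ge 0$ the map $\mathcal N_G^{G\times C_p}$ sends $\Gamma^n(G)$ into $\Gamma^{pn}(G\times C_p)$ and induces a well-defined map $$\mathcal N_G^{G\times C_p}:\Gamma^n(G)/\Gamma^{n+1}(G)\to \Gamma^{pn}(G\times C_p)/\Gamma^{pn+1}(G\times C_p).$$ Let $\sigma$ be a one-dimensional complex representation of $G$, and let $\rho$ be a one-dimensional complex representation of $C_p$ whose character generates the ring $R_{\mathbb C}(C_p)$. Let $\overline\sigma$ and $\overline\rho$ be their pullbacks to $G\times C_p$ along the two projections, and put $x=c_1(\sigma)\in R^*_{\mathbb C}(G)$ and $y=c_1(\overline\rho)$, $z=c_1(\overline\sigma)\in R^*_{\mathbb C}(G\times C_p)$. Then, in $R^*_{\mathbb C}(G\times C_p)$, $$\mathcal N_G^{G\times C_p}(x)=z^p-z\,y^{p-1}.$$ 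-/

import Mathlib

open scoped TensorProduct DirectSum Pointwise

noncomputable section

namespace CharRing

/-! ### The ring of virtual characters -/

/-- The action on a finite-dimensional complex representation, as a `Representation`. -/
abbrev act {G : Type*} [Group G] (V : FDRep ℂ G) : Representation ℂ G V := V.ρ

theorem char_of {G : Type*} [Group G] {V : Type} [AddCommGroup V] [Module ℂ V] [Module.Finite ℂ V]
    (ρ : Representation ℂ G V) : (act (FDRep.of ρ)).character = ρ.character := rfl

theorem char_prod {G : Type*} [Group G] {V W : Type} [AddCommGroup V] [Module ℂ V]
    [Module.Finite ℂ V] [AddCommGroup W] [Module ℂ W] [Module.Finite ℂ W]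
    (ρ : Representation ℂ G V) (σ : Representation ℂ G W) :
    (ρ.prod σ).character = ρ.character + σ.character := by
  ext g
  exact LinearMap.trace_prodMap' (ρ g) (σ g)

theorem char_zero (G : Type*) [Group G] :
    (Representation.trivial ℂ G PUnit.{1}).character = 0 := by
  ext g
  simp [Representation.character]

theorem char_triv (G : Type*) [Group G] : (Representation.trivial ℂ G ℂ).character = 1 := by
  ext g
  simp [Representation.character]

/-- The ring `R(G)` of virtual characters of `G` over `ℂ`: the functions `χ_V - χ_W`, where `V`, `W`
are finite-dimensional complex representations, with pointwise operations (which correspond to the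
direct sum and the tensor product of representations). -/
def VirtualChar (G : Type*) [Group G] : Subring (G → ℂ) where
  carrier := {f | ∃ V W : FDRep ℂ G, f = (act V).character - (act W).character}
  zero_mem' := ⟨FDRep.of (Representation.trivial ℂ G ℂ), FDRep.of (Representation.trivial ℂ G ℂ),
    (sub_self _).symm⟩
  one_mem' := ⟨FDRep.of (Representation.trivial ℂ G ℂ),
    FDRep.of (Representation.trivial ℂ G PUnit), by
      rw [char_of, char_of, char_zero, char_triv, sub_zero]⟩
  neg_mem' := by
    rintro _ ⟨V, W, rfl⟩
    exact ⟨W, V, neg_sub _ _⟩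
  add_mem' := by
    rintro _ _ ⟨V, W, rfl⟩ ⟨V', W', rfl⟩
    refine ⟨FDRep.of ((act V).prod (act V')), FDRep.of ((act W).prod (act W')), ?_⟩
    rw [char_of, char_of, char_prod, char_prod]
    ring
  mul_mem' := by
    rintro _ _ ⟨V, W, rfl⟩ ⟨V', W', rfl⟩
    refine ⟨FDRep.of (((act V).tprod (act V')).prod ((act W).tprod (act W'))),
      FDRep.of (((act V).tprod (act W')).prod ((act W).tprod (act V'))), ?_⟩
    rw [char_of, char_of, char_prod, char_prod, Representation.char_tensor,
      Representation.char_tensor, Representation.char_tensor, Representation.char_tensor]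
    ring

section Lambda

variable {G : Type*} [Group G]

/-- The class of a representation in `R(G)`, that is, its character. -/
def ofRep (V : FDRep ℂ G) : VirtualChar G :=
  ⟨(act V).character, V, FDRep.of (Representation.trivial ℂ G PUnit), by
    rw [char_of, char_zero, sub_zero]⟩

/-- A representation `V` in a chosen presentation `x = [V] - [W]` of a virtual character. -/
def posPart (x : VirtualChar G) : FDRep ℂ G := x.2.choose

/-- The representation `W` in the chosen presentation `x = [V] - [W]` of a virtual character. -/
def negPart (x : VirtualChar G) : FDRep ℂ G := x.2.choose_spec.choose

theorem posPart_sub_negPart (x : VirtualChar G) : ofRep (posPart x) - ofRep (negPart x) = x :=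
  Subtype.ext x.2.choose_spec.choose_spec.symm

/-- The augmentation `ε : R(G) → ℂ`, sending a character to its degree; its values are the
integers `dim V - dim W`. -/
def augmentation (G : Type*) [Group G] : VirtualChar G →+* ℂ :=
  (Pi.evalRingHom (fun _ : G => ℂ) 1).comp (VirtualChar G).subtype

theorem augmentation_ofRep (V : FDRep ℂ G) :
    augmentation G (ofRep V) = Module.finrank ℂ V := by
  exact Representation.char_one (act V)

/-- The augmentation ideal `I`. -/
def augIdeal (G : Type*) [Group G] : Ideal (VirtualChar G) := RingHom.ker (augmentation G)

/-- The `n`-th exterior power of a representation. -/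
def extPow (n : ℕ) (V : FDRep ℂ G) : FDRep ℂ G :=
  FDRep.of (V := ⋀[ℂ]^n (V : Type))
    { toFun := fun g => exteriorPower.map n (act V g)
      map_one' := by rw [map_one]; exact exteriorPower.map_id
      map_mul' := fun g h => by
        rw [map_mul]; exact exteriorPower.map_comp (n := n) (act V h) (act V g) }

/-- `λ_t(V) = ∑ₙ [Λⁿ V] tⁿ`. -/
def lambdaSeries (V : FDRep ℂ G) : PowerSeries (VirtualChar G) :=
  PowerSeries.mk fun n => ofRep (extPow n V)

/-- The operation `λⁿ` on `R(G)`: the extension of exterior powers from representations to virtual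
characters for which `λ_t` is multiplicative, that is, `λ_t([V] - [W]) = λ_t(V) λ_t(W)⁻¹`
(`λ_t(W)` has constant coefficient `1`, and the value does not depend on the presentation). -/
def lambdaOp (n : ℕ) (x : VirtualChar G) : VirtualChar G :=
  PowerSeries.coeff n
    (lambdaSeries (posPart x) * PowerSeries.invOfUnit (lambdaSeries (negPart x)) 1)

/-- The operation `γⁿ(x) = λⁿ(x + n - 1)`. -/
def gammaOp (n : ℕ) (x : VirtualChar G) : VirtualChar G := lambdaOp n (x + n - 1)

end Lambda

/-! ### The Grothendieck filtration and the graded character ring -/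

/-- The monomials `γ^{n₁}(x₁) ⋯ γ^{n_k}(x_k)` with `xᵢ ∈ I` and `n₁ + ⋯ + n_k ≥ n`. -/
def gammaMonomials (G : Type*) [Group G] (n : ℕ) : Set (VirtualChar G) :=
  {m | ∃ l : List (ℕ × augIdeal G), n ≤ (l.map Prod.fst).sum ∧
    m = (l.map fun a => gammaOp a.1 (a.2 : VirtualChar G)).prod}

/-- The `n`-th term `Γⁿ` of the Grothendieck filtration. -/
def Gam (G : Type*) [Group G] (n : ℕ) : AddSubgroup (VirtualChar G) :=
  AddSubgroup.closure (gammaMonomials G n)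

theorem Gam_mul {G : Type*} [Group G] {m n : ℕ} {a b : VirtualChar G} (ha : a ∈ Gam G m)
    (hb : b ∈ Gam G n) : a * b ∈ Gam G (m + n) := by
  unfold Gam at ha hb
  refine AddSubgroup.closure_induction (p := fun a _ => a * b ∈ Gam G (m + n)) ?_ ?_ ?_ ?_ ha
  · intro x hx
    refine AddSubgroup.closure_induction (p := fun b _ => x * b ∈ Gam G (m + n)) ?_ ?_ ?_ ?_ hb
    · intro y hy
      obtain ⟨l, hl, rfl⟩ := hx
      obtain ⟨l', hl', rfl⟩ := hy
      exact AddSubgroup.subset_closure ⟨l ++ l', by simpa using add_le_add hl hl', by simp⟩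
    · simp [zero_mem]
    · intro y z _ _ h1 h2
      rw [mul_add]; exact add_mem h1 h2
    · intro y _ h
      rw [mul_neg]; exact neg_mem h
  · simp [zero_mem]
  · intro y z _ _ h1 h2
    rw [add_mul]; exact add_mem h1 h2
  · intro y _ h
    rw [neg_mul]; exact neg_mem h

theorem one_mem_Gam (G : Type*) [Group G] : (1 : VirtualChar G) ∈ Gam G 0 :=
  AddSubgroup.subset_closure ⟨[], by simp, by simp⟩

/-- `Γⁿ⁺¹` as a subgroup of `Γⁿ`. -/
def GamSucc (G : Type*) [Group G] (n : ℕ) : AddSubgroup (Gam G n) :=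
  (Gam G (n + 1)).addSubgroupOf (Gam G n)

/-- The graded piece `Γⁿ / Γⁿ⁺¹`. -/
def Gr (G : Type*) [Group G] (n : ℕ) : Type _ := Gam G n ⧸ GamSucc G n

instance (G : Type*) [Group G] (n : ℕ) : AddCommGroup (Gr G n) :=
  inferInstanceAs (AddCommGroup (Gam G n ⧸ GamSucc G n))

/-- The class in `Γⁿ / Γⁿ⁺¹` of an element of `Γⁿ`. -/
def grMk {G : Type*} [Group G] (n : ℕ) : Gam G n →+ Gr G n := QuotientAddGroup.mk' (GamSucc G n)

section GradedRing

variable {G : Type*} [Group G]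

theorem grMk_surjective (n : ℕ) : Function.Surjective (grMk (G := G) n) :=
  QuotientAddGroup.mk'_surjective _

theorem grMk_eq_iff {n : ℕ} {a b : Gam G n} :
    grMk n a = grMk n b ↔ (-a + b : VirtualChar G) ∈ Gam G (n + 1) :=
  (QuotientAddGroup.eq (s := GamSucc G n)).trans AddSubgroup.mem_addSubgroupOf

/-- The product `Γᵐ × Γⁿ → Γᵐ⁺ⁿ`. -/
def gamMul (m n : ℕ) (a : Gam G m) (b : Gam G n) : Gam G (m + n) :=
  ⟨a * b, Gam_mul a.2 b.2⟩

/-- The product `Γᵐ/Γᵐ⁺¹ × Γⁿ/Γⁿ⁺¹ → Γᵐ⁺ⁿ/Γᵐ⁺ⁿ⁺¹`, given by the product of representatives. -/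
def grMul (m n : ℕ) : Gr G m → Gr G n → Gr G (m + n) :=
  Quotient.map₂ (gamMul m n) (by
    intro a a' ha b b' hb
    have ha' : (-a + a' : VirtualChar G) ∈ Gam G (m + 1) := grMk_eq_iff.1 (Quotient.sound ha)
    have hb' : (-b + b' : VirtualChar G) ∈ Gam G (n + 1) := grMk_eq_iff.1 (Quotient.sound hb)
    refine Quotient.exact (grMk_eq_iff.2 ?_)
    have h1 := Gam_mul ha' b.2
    have h2 := Gam_mul a'.2 hb'
    rw [show m + 1 + n = m + n + 1 by ring] at h1
    have h3 := add_mem h1 (show _ ∈ Gam G (m + n + 1) from h2)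
    convert h3 using 1
    simp only [gamMul]
    ring)

theorem grMul_mk (m n : ℕ) (a : Gam G m) (b : Gam G n) :
    grMul m n (grMk m a) (grMk n b) = grMk (m + n) (gamMul m n a b) := rfl

theorem gradedMonoid_mk_eq {m n : ℕ} (h : m = n) {a : Gam G m} {b : Gam G n}
    (hab : (a : VirtualChar G) = b) :
    (GradedMonoid.mk m (grMk m a) : GradedMonoid (Gr G)) = GradedMonoid.mk n (grMk n b) := by
  subst h
  rw [Subtype.ext hab]

instance : GradedMonoid.GOne (Gr G) where
  one := grMk 0 ⟨1, one_mem_Gam G⟩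

instance : GradedMonoid.GMul (Gr G) where
  mul := fun {m n} a b => grMul m n a b

instance : DirectSum.GCommRing (Gr G) where
  mul := fun {m n} a b => grMul m n a b
  mul_zero := by
    intro m n a
    obtain ⟨a, rfl⟩ := grMk_surjective m a
    rw [← map_zero (grMk (G := G) n), grMul_mk, ← map_zero (grMk (G := G) (m + n))]
    congr 1
    exact Subtype.ext (mul_zero _)
  zero_mul := by
    intro m n a
    obtain ⟨a, rfl⟩ := grMk_surjective n a
    rw [← map_zero (grMk (G := G) m), grMul_mk, ← map_zero (grMk (G := G) (m + n))]
    congr 1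
    exact Subtype.ext (zero_mul _)
  mul_add := by
    intro m n a b c
    obtain ⟨a, rfl⟩ := grMk_surjective m a
    obtain ⟨b, rfl⟩ := grMk_surjective n b
    obtain ⟨c, rfl⟩ := grMk_surjective n c
    rw [← map_add, grMul_mk, grMul_mk, grMul_mk, ← map_add]
    congr 1
    exact Subtype.ext (mul_add _ _ _)
  add_mul := by
    intro m n a b c
    obtain ⟨a, rfl⟩ := grMk_surjective m a
    obtain ⟨b, rfl⟩ := grMk_surjective m b
    obtain ⟨c, rfl⟩ := grMk_surjective n c
    rw [← map_add, grMul_mk, grMul_mk, grMul_mk, ← map_add]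
    congr 1
    exact Subtype.ext (add_mul _ _ _)
  one := grMk 0 ⟨1, one_mem_Gam G⟩
  one_mul := by
    rintro ⟨n, a⟩
    obtain ⟨a, rfl⟩ := grMk_surjective n a
    exact gradedMonoid_mk_eq (zero_add n) (one_mul _)
  mul_one := by
    rintro ⟨n, a⟩
    obtain ⟨a, rfl⟩ := grMk_surjective n a
    exact gradedMonoid_mk_eq (add_zero n) (mul_one _)
  mul_assoc := by
    rintro ⟨m, a⟩ ⟨n, b⟩ ⟨k, c⟩
    obtain ⟨a, rfl⟩ := grMk_surjective m a
    obtain ⟨b, rfl⟩ := grMk_surjective n b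
    obtain ⟨c, rfl⟩ := grMk_surjective k c
    exact gradedMonoid_mk_eq (add_assoc m n k) (mul_assoc _ _ _)
  mul_comm := by
    rintro ⟨m, a⟩ ⟨n, b⟩
    obtain ⟨a, rfl⟩ := grMk_surjective m a
    obtain ⟨b, rfl⟩ := grMk_surjective n b
    exact gradedMonoid_mk_eq (add_comm m n) (mul_comm _ _)
  natCast k := k • grMk 0 ⟨1, one_mem_Gam G⟩
  natCast_zero := zero_smul _ _
  natCast_succ k := succ_nsmul _ _
  intCast k := k • grMk 0 ⟨1, one_mem_Gam G⟩
  intCast_ofNat k := natCast_zsmul _ _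
  intCast_negSucc_ofNat k := negSucc_zsmul _ _

/-- The graded character ring `R^*(G) = ⨁ₙ Γⁿ / Γⁿ⁺¹`. -/
abbrev GradedCharRing (G : Type*) [Group G] : Type _ := ⨁ n, Gr G n

/-- `Cₙ(V) = γⁿ(V - ε(V))`, an element of `Γⁿ`. -/
def chernLift (n : ℕ) (V : FDRep ℂ G) : Gam G n :=
  ⟨gammaOp n (ofRep V - (Module.finrank ℂ V : VirtualChar G)),
    AddSubgroup.subset_closure
      ⟨[(n, ⟨ofRep V - (Module.finrank ℂ V : VirtualChar G), by
        rw [augIdeal, RingHom.mem_ker, map_sub, augmentation_ofRep, map_natCast, sub_self]⟩)],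
        by simp, by simp⟩⟩

/-- The `n`-th algebraic Chern class `cₙ(V)`, in `Γⁿ / Γⁿ⁺¹`. -/
def chernGr (n : ℕ) (V : FDRep ℂ G) : Gr G n := grMk n (chernLift n V)

/-- The `n`-th algebraic Chern class `cₙ(V)`, in `R^*(G)`. -/
def chern (n : ℕ) (V : FDRep ℂ G) : GradedCharRing G := DirectSum.of (Gr G) n (chernGr n V)

/-- The representation of `G` pulled back from a representation of `H` along `f : G → H`. -/
def pullback {H : Type*} [Group H] (f : G →* H) (V : FDRep ℂ H) : FDRep ℂ G :=
  FDRep.of ((act V).comp f)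

end GradedRing

/-! ### Tensor induction of virtual characters -/

section Norm

variable {H K : Type*} [Group H] [Group K] (i : H →* K) (hi : Function.Injective i)

/-- For the chosen representatives `t(c)` of the left cosets of `H` in `K`, the element
`t(c)⁻¹ g t(g⁻¹c)` of `H`. -/
def cosetShift (g : K) (c : K ⧸ i.range) : H :=
  (MonoidHom.ofInjective hi).symm ⟨c.out⁻¹ * g * (g⁻¹ • c).out, by
    rw [mul_assoc, ← QuotientGroup.eq]
    simp only [QuotientGroup.out_eq']
    rw [← smul_eq_mul, ← MulAction.Quotient.smul_coe, QuotientGroup.out_eq', smul_inv_smul]⟩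

theorem map_cosetShift (g : K) (c : K ⧸ i.range) :
    i (cosetShift i hi g c) = c.out⁻¹ * g * (g⁻¹ • c).out :=
  congrArg Subtype.val ((MonoidHom.ofInjective hi).apply_symm_apply _)

theorem cosetShift_mul (g g' : K) (c : K ⧸ i.range) :
    cosetShift i hi (g * g') c = cosetShift i hi g c * cosetShift i hi g' (g⁻¹ • c) := by
  apply hi
  simp only [map_mul, map_cosetShift, mul_inv_rev, mul_smul]
  group

theorem cosetShift_one (c : K ⧸ i.range) : cosetShift i hi 1 c = 1 := by
  apply hi
  simp [map_cosetShift]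

/-- The permutation of a set `C` of cosets by an element of its stabilizer. -/
def stabPerm (C : Finset (K ⧸ i.range)) (g : MulAction.stabilizer K (C : Set (K ⧸ i.range))) :
    C ≃ C :=
  (MulAction.toPerm (g : K)).subtypeEquiv fun c => by
    have h := MulAction.mem_stabilizer_iff.1 g.2
    rw [MulAction.toPerm_apply, ← Finset.mem_coe, ← Finset.mem_coe]
    nth_rewrite 2 [← h]
    exact (Set.smul_mem_smul_set_iff).symm

theorem stabPerm_symm_coe (C : Finset (K ⧸ i.range))
    (g : MulAction.stabilizer K (C : Set (K ⧸ i.range))) (c : C) :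
    (((stabPerm i C g).symm c : C) : K ⧸ i.range) = (g : K)⁻¹ • (c : K ⧸ i.range) := by
  rw [eq_inv_smul_iff]
  exact congrArg Subtype.val ((stabPerm i C g).apply_symm_apply c)

/-- The map `⨂ w_c ↦ ⨂ (t(c)⁻¹ g t(g⁻¹c)) w_{g⁻¹c}` on `⨂_{c ∈ C} W`. -/
def tensorAct (W : FDRep ℂ H) (C : Finset (K ⧸ i.range))
    (g : MulAction.stabilizer K (C : Set (K ⧸ i.range))) :
    (⨂[ℂ] _ : C, (W : Type)) →ₗ[ℂ] (⨂[ℂ] _ : C, (W : Type)) :=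
  PiTensorProduct.map (fun c : C => act W (cosetShift i hi (g : K) c)) ∘ₗ
    (PiTensorProduct.reindex ℂ (fun _ : C => (W : Type)) (stabPerm i C g)).toLinearMap

theorem tensorAct_tprod (W : FDRep ℂ H) (C : Finset (K ⧸ i.range))
    (g : MulAction.stabilizer K (C : Set (K ⧸ i.range))) (w : C → (W : Type)) :
    tensorAct i hi W C g (PiTensorProduct.tprod ℂ w) =
      PiTensorProduct.tprod ℂ fun c : C =>
        act W (cosetShift i hi (g : K) c) (w ((stabPerm i C g).symm c)) := by
  unfold tensorAct
  rw [LinearMap.comp_apply, LinearEquiv.coe_coe, PiTensorProduct.reindex_tprod]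
  exact PiTensorProduct.map_tprod _ _

/-- For a representation `W` of `H` and a set `C` of left cosets of `H` in `K`, the representation
`W^{⊗ C} = ⨂_{c ∈ C} t(c) ⊗ W` of the stabilizer of `C` in `K`. When `C` is the set of all cosets,
this is the usual tensor induction of `W` from `H` to `K`. -/
def tensorRep (W : FDRep ℂ H) (C : Finset (K ⧸ i.range)) :
    Representation ℂ (MulAction.stabilizer K (C : Set (K ⧸ i.range)))
      (⨂[ℂ] _ : C, (W : Type)) where
  toFun g := tensorAct i hi W C g
  map_one' := by
    refine PiTensorProduct.ext (MultilinearMap.ext fun w => ?_)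
    rw [LinearMap.compMultilinearMap_apply, LinearMap.compMultilinearMap_apply, tensorAct_tprod,
      Module.End.one_apply]
    congr 1
    funext c
    rw [OneMemClass.coe_one, cosetShift_one, map_one, Module.End.one_apply]
    congr 1
    apply Subtype.ext
    rw [stabPerm_symm_coe, OneMemClass.coe_one, inv_one, one_smul]
  map_mul' g g' := by
    refine PiTensorProduct.ext (MultilinearMap.ext fun w => ?_)
    rw [LinearMap.compMultilinearMap_apply, LinearMap.compMultilinearMap_apply, tensorAct_tprod,
      Module.End.mul_apply, tensorAct_tprod, tensorAct_tprod]
    congr 1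
    funext c
    have h : (stabPerm i C (g * g')).symm c = (stabPerm i C g').symm ((stabPerm i C g).symm c) := by
      apply Subtype.ext
      simp only [stabPerm_symm_coe, Subgroup.coe_mul, mul_inv_rev, mul_smul]
    rw [h, stabPerm_symm_coe, Subgroup.coe_mul, cosetShift_mul, map_mul, Module.End.mul_apply]

open Classical in
/-- The virtual character of the bundle `χ(W)` over the `K`-set of all subsets `C` of `K/H`, with
fibre `W^{⊗ C}` at `C`. Virtual bundles over this `K`-set are represented by their characters: the
functions of `g : K` and `C` with `gC = C` giving the trace of `g` on the fibre at `C`, extended by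
zero to the other pairs. -/
def chiRep (W : FDRep ℂ H) (g : K) (C : Finset (K ⧸ i.range)) : ℂ :=
  if h : g ∈ MulAction.stabilizer K (C : Set (K ⧸ i.range)) then
    (tensorRep i hi W C).character ⟨g, h⟩
  else 0

open Classical in
/-- The operation `z ∨ t = m_*(p₁^* z · p₂^* t)` on virtual bundles over the set of subsets of a
`K`-set, where `m`, `p₁`, `p₂` send a pair of disjoint subsets `(C₁, C₂)` to `C₁ ⊔ C₂`, `C₁`, `C₂`:
the trace of `g` at `C` is the sum of `z(g, C₁) t(g, C₂)` over `C = C₁ ⊔ C₂` with `gC₁ = C₁`,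
`gC₂ = C₂`. -/
def vee {L X : Type*} (z t : L → Finset X → ℂ) (g : L) (C : Finset X) : ℂ :=
  ∑ D ∈ C.powerset, z g D * t g (C \ D)

open Classical in
/-- The unit of `∨`: the trivial line at the empty set. -/
def veeOne {L X : Type*} (_ : L) (C : Finset X) : ℂ := if C = ∅ then 1 else 0

open Classical in
/-- The inverse for `∨` of a virtual bundle with fibre `1` at the empty set. -/
def veeInv {L X : Type*} (a : L → Finset X → ℂ) (g : L) (C : Finset X) : ℂ :=
  if C = ∅ then 1 else -∑ D ∈ C.ssubsets.attach, a g (C \ D.1) * veeInv a g D.1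
termination_by C.card
decreasing_by exact Finset.card_lt_card (Finset.mem_ssubsets.1 D.2)

theorem vee_veeInv {L X : Type*} (a : L → Finset X → ℂ) (ha : ∀ g, a g ∅ = 1) :
    vee (veeInv a) a = veeOne := by
  classical
  funext g C
  unfold vee veeOne
  split_ifs with h
  · subst h
    rw [Finset.powerset_empty, Finset.sum_singleton, veeInv, if_pos rfl, one_mul]
    convert ha g using 2
    exact sdiff_self
  · rw [← Finset.insert_erase (Finset.mem_powerset_self C), Finset.sum_insert (by simp), veeInv,
      if_neg h]
    have : ∑ D ∈ C.powerset.erase C, veeInv a g D * a g (C \ D) =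
        ∑ D ∈ C.ssubsets.attach, a g (C \ D.1) * veeInv a g D.1 := by
      rw [Finset.sum_attach C.ssubsets fun D => a g (C \ D) * veeInv a g D]
      exact Finset.sum_congr rfl fun D _ => mul_comm _ _
    convert neg_add_cancel _ using 2
    rw [sdiff_self, Finset.bot_eq_empty, ha, mul_one, this]

/-- The norm (tensor induction) `N : R(H) → R(K)` along an injective homomorphism `i : H → K`, on
all virtual characters: `N(V - W) = (χ(V) ∨ χ(W)^{-1})_{K/H}`, where the inverse is taken for `∨`.
Since `χ(V ⊕ V') = χ(V) ∨ χ(V')`, it does not depend on the presentation, and it sends a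
representation to its tensor induction. -/
def tensorNorm [Finite K] (x : VirtualChar H) : K → ℂ := fun g =>
  letI := Fintype.ofFinite (K ⧸ i.range)
  vee (chiRep i hi (posPart x)) (veeInv (chiRep i hi (negPart x))) g Finset.univ

theorem inl_injective (H K : Type*) [Group H] [Group K] :
    Function.Injective (MonoidHom.inl H K) := fun _ _ h => congrArg Prod.fst h

/-- `N` is the norm in degree `n` between graded character rings: it is given by the norm of
virtual characters on representatives. Since every class has a representative, there is at most
one such map. -/
def IsGradedNorm [Finite K] (n : ℕ) (N : Gr H n → Gr K (i.range.index * n)) : Prop :=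
  ∀ X : Gam H n, ∃ Y : Gam K (i.range.index * n),
    ((Y : VirtualChar K) : K → ℂ) = tensorNorm i hi (X : VirtualChar H) ∧ N (grMk n X) = grMk _ Y

end Norm

end CharRing

end

/-! Everything is read off from character values. Let `H` have prime index `p` in an abelian `K`. An
element of `H` fixes every coset, so `χ(V)` at `D` has trace `v ^ |D|`, and the binomial theorem
gives `N(x)(h) = x(h) ^ p` (`tensorNorm_of_mem_range`). An element `g` outside `H` acts transitively
on `K/H`, so only the empty set and the whole set carry traces, and `N(x)(g) = x(g ^ p)`
(`tensorNorm_of_notMem_range`).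

For `K = G × C` these two formulas show that `N` is multiplicative, that its defect of additivity is
the regular character of `C` times `((x + y) ^ p - x ^ p - y ^ p) / p` (`nm_add`), and that `N(χ -
1) = ∏_{j < p} (χ - ψ ^ j)` (`nm_linChar_sub_one`), by the factorization of `X ^ p - 1`.

Since representations of abelian groups are diagonalizable, `Γⁿ` is the power `Iⁿ` of the
augmentation ideal (`mem_Gam_iff`). The additivity defect is small for the `I`-adic filtration
(`crossTerm_mem`), so `N` maps `Iⁿ` into `I ^ (p * n)` (`exists_nm_eq`) and descends to graded
pieces (`nm_sub_mem`).

Finally `χ - ψ ^ j` has class `z - j y`, and `p y = 0` because `ψ ^ p = 1`. Hence `∏ (z - j y)`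
collapses to `z ^ p - z y ^ (p - 1)`, as `∏ (X - j)` does to `X ^ p - X` modulo `p`
(`prod_sub_nsmul_eq`). -/

namespace CharRing

/-! ### Commutative algebra: the product formula and gamma operations on line elements. -/

section Algebra

open Polynomial in
/-- The homogeneous form of `∏_{j < p} (X - j) = X ^ p - X` over the field with `p` elements. -/
theorem prod_sub_nsmul_eq {A : Type*} [CommRing A] {p : ℕ} (hp : p.Prime) (z y : A)
    (hy : (p : A) * y = 0) :
    ∏ j ∈ Finset.range p, (z - j * y) = z ^ p - z * y ^ (p - 1) := by
  have := Fact.mk hp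
  set q : ℤ[X] := ∏ j ∈ Finset.range p, (X - C (j : ℤ)) with hq
  set d : ℤ[X] := q - (X ^ p - X) with hd
  have hmonic : q.Monic := monic_prod_of_monic _ _ fun j _ => monic_X_sub_C _
  have hdeg : q.degree = p := by
    rw [hq, degree_prod]
    simp only [degree_X_sub_C]
    simp
  have hXdeg : (X : ℤ[X]).degree < (p : WithBot ℕ) := by
    rw [degree_X]; exact_mod_cast hp.one_lt
  have hXpdeg : ((X : ℤ[X]) ^ p - X).degree = (p : WithBot ℕ) := by
    rw [degree_sub_eq_left_of_degree_lt] <;> rw [degree_X_pow]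
    exact hXdeg
  -- Both polynomials are monic of degree `p`, so every monomial of the homogenized difference
  -- contains a factor `y`, which its coefficient, divisible by `p`, kills.
  have hd_deg : d.degree < p := by
    rw [← hdeg]
    refine degree_sub_lt_left (hdeg.trans hXpdeg.symm) hmonic.ne_zero ?_
    rw [hmonic.leadingCoeff]
    exact ((monic_X_pow p).sub_of_left (by rwa [degree_X_pow])).leadingCoeff.symm
  have hd_coeff : ∀ k, (p : ℤ) ∣ d.coeff k := by
    intro k
    rw [← ZMod.intCast_zmod_eq_zero_iff_dvd _ p]
    have h0 : d.map (Int.castRingHom (ZMod p)) = 0 := by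
      have h1 := FiniteField.X_pow_card_sub_X_natDegree_eq (ZMod p) hp.one_lt
      have h2 : (∏ a : ZMod p, (X - C a) : (ZMod p)[X]) = X ^ p - X := by
        have hroots := FiniteField.roots_X_pow_card_sub_X (ZMod p)
        rw [ZMod.card] at hroots
        have hmon : (X ^ p - X : (ZMod p)[X]).Monic :=
          (monic_X_pow p).sub_of_left (by rw [degree_X_pow, degree_X]; exact_mod_cast hp.one_lt)
        have := prod_multiset_X_sub_C_of_monic_of_roots_card_eq hmon (by
          rw [hroots, h1]; simp [ZMod.card])
        rwa [hroots] at this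
      have h3 : ∏ j ∈ Finset.range p, (X - C ((j : ℕ) : ZMod p)) =
          (∏ a : ZMod p, (X - C a) : (ZMod p)[X]) := by
        refine Finset.prod_bij (fun j _ => (j : ZMod p)) (by simp) ?_ ?_ (by simp)
        · intro a ha b hb h
          rw [ZMod.natCast_eq_natCast_iff] at h
          exact Nat.ModEq.eq_of_lt_of_lt h (Finset.mem_range.1 ha) (Finset.mem_range.1 hb)
        · intro b _
          exact ⟨b.val, Finset.mem_range.2 b.val_lt, by simp⟩
      rw [hd, hq, Polynomial.map_sub, Polynomial.map_prod]
      simp only [Polynomial.map_sub, Polynomial.map_X, Polynomial.map_pow, Polynomial.map_C,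
        Int.coe_castRingHom, Int.cast_natCast]
      rw [h3, h2, sub_self]
    have := congrArg (fun r => r.coeff k) h0
    simpa [coeff_map] using this
  choose s hs using hd_coeff
  let φ : MvPolynomial (Fin 2) ℤ →ₐ[ℤ] A := MvPolynomial.aeval ![z, y]
  have hφd : φ (d.homogenize p) = 0 := by
    rw [d.as_sum_range_C_mul_X_pow' (n := p) (by
      rcases eq_or_ne d 0 with h | h
      · rw [h]; simpa using hp.pos
      · exact (natDegree_lt_iff_degree_lt h).2 hd_deg),
      homogenize_finsetSum, map_sum]
    refine Finset.sum_eq_zero fun k hk => ?_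
    have hk' := Finset.mem_range.1 hk
    rw [homogenize_C_mul, homogenize_X_pow hk'.le, hs k]
    obtain ⟨e, he⟩ := Nat.exists_eq_add_of_lt hk'
    rw [show p - k = e + 1 by omega]
    simp only [φ, map_mul, map_pow, MvPolynomial.aeval_X, MvPolynomial.aeval_C]
    simp only [algebraMap_int_eq, eq_intCast, Int.cast_natCast, Matrix.cons_val_zero,
      Matrix.cons_val_one]
    linear_combination (s k : A) * z ^ k * y ^ e * hy
  have hφq : φ (q.homogenize p) = ∏ j ∈ Finset.range p, (z - j * y) := by
    have := homogenize_finsetProd (s := Finset.range p) (p := fun j => (X - C (j : ℤ)))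
      (n := fun _ => 1) (fun j _ => natDegree_X_sub_C_le _)
    rw [Finset.sum_const, smul_eq_mul, mul_one, Finset.card_range] at this
    rw [hq, this, map_prod]
    refine Finset.prod_congr rfl fun j _ => ?_
    rw [homogenize_sub, homogenize_X one_ne_zero, homogenize_C]
    simp [φ]
  have hqd : q = d + X ^ p - X := by rw [hd]; ring
  rw [← hφq, hqd, homogenize_sub, homogenize_add, map_sub, map_add, hφd,
    homogenize_X_pow le_rfl, homogenize_X hp.ne_zero]
  simp [φ]

-- Inverting each factor by a truncated geometric series keeps the coefficient of `X ^ d` in `I ^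
-- d`; membership in the Rees algebra records exactly this.
open Polynomial in
theorem exists_inverse_mod_X_pow {R : Type*} [CommRing R] (I : Ideal R) {κ : Type*}
    (t : Finset κ) (b : κ → R) (hb : ∀ j, b j ∈ I) (n : ℕ) :
    ∃ h ∈ reesAlgebra I, (X : R[X]) ^ n ∣ (∏ j ∈ t, (1 + C (b j) * X)) * h - 1 := by
  classical
  induction t using Finset.induction_on with
  | empty => exact ⟨1, one_mem _, by simp⟩
  | insert j t hj ih =>
    obtain ⟨h, hh, q, hq⟩ := ih
    have hmem : -(C (b j) * X : R[X]) ∈ reesAlgebra I := by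
      rw [C_mul_X_eq_monomial]
      exact neg_mem (reesAlgebra.monomial_mem.2 (by simpa using hb j))
    refine ⟨h * ∑ k ∈ Finset.range n, (-(C (b j) * X)) ^ k,
      mul_mem hh (sum_mem fun k _ => pow_mem hmem k), ?_⟩
    have hg := mul_neg_geom_sum (-(C (b j) * X : R[X])) n
    rw [Finset.prod_insert hj]
    refine ⟨q - C ((-b j) ^ n) * (1 + q * X ^ n), ?_⟩
    rw [sub_neg_eq_add, neg_pow _ n, mul_pow] at hg
    rw [neg_pow (b j), C_mul, C_pow, C_pow, C_neg, C_1]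
    linear_combination (1 - (-1) ^ n * (C (b j) ^ n * X ^ n)) * hq +
      (∏ j ∈ t, (1 + C (b j) * X)) * h * hg

-- With `s = X / (1 + X)` one has `1 + a X = (1 + X) (1 + (a - 1) s)`, so the quotient is `(1 + X) ^
-- n` times a series in `s` whose coefficient of `s ^ d` lies in `I ^ d`. This is the computation
-- behind `γⁿ⁺¹(x) ∈ Iⁿ⁺¹`.
open PowerSeries in
theorem coeff_prod_mul_inverse_mem {R : Type*} [CommRing R] (I : Ideal R) {k l n : ℕ}
    (a : Fin k → R) (b : Fin l → R) (ha : ∀ i, a i - 1 ∈ I)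
    (hb : ∀ j, b j - 1 ∈ I) (hn : k = l + n) (Q : R⟦X⟧)
    (hQ : (∏ j, (1 + C (b j) * X)) * Q = 1) :
    coeff (n + 1) ((∏ i, (1 + C (a i) * X)) * Q) ∈ I ^ (n + 1) := by
  obtain ⟨u, hu⟩ : ∃ u : R⟦X⟧, (1 + X) * u = 1 :=
    ⟨invOfUnit (1 + X) 1, mul_invOfUnit _ _ (by simp)⟩
  let ev : Polynomial R →ₐ[R] R⟦X⟧ := Polynomial.aeval (X * u)
  have key : ∀ {m : ℕ} (c : Fin m → R), ∏ i, (1 + C (c i) * X) =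
      (1 + X) ^ m *
        ev (∏ i, (1 + Polynomial.C (c i - 1) * Polynomial.X)) := by
    intro m c
    rw [map_prod, ← Fin.prod_const, ← Finset.prod_mul_distrib]
    refine Finset.prod_congr rfl fun i _ => ?_
    simp only [ev, map_add, map_one, map_mul, Polynomial.aeval_C, Polynomial.aeval_X, map_sub]
    have hC : (algebraMap R R⟦X⟧) (c i) = C (c i) := rfl
    rw [hC]
    linear_combination (-(C (c i) - 1) * X) * hu
  -- Precision `n + 2` keeps the error out of the coefficient of degree `n + 1`.
  obtain ⟨h, hh, q, hq⟩ := exists_inverse_mod_X_pow I Finset.univ (fun j => b j - 1) hb (n + 2)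
  set f : Polynomial R := ∏ i, (1 + Polynomial.C (a i - 1) * Polynomial.X) with hf
  have hfmem : f ∈ reesAlgebra I := prod_mem fun i _ => add_mem (one_mem _) (by
    rw [Polynomial.C_mul_X_eq_monomial]
    exact reesAlgebra.monomial_mem.2 (by simpa using ha i))
  have hfh := mul_mem hfmem hh
  have hq' := congrArg ev hq
  rw [map_sub, map_mul, map_mul, map_pow, map_one] at hq'
  have hX : ev Polynomial.X = X * u := Polynomial.aeval_X _
  rw [hX] at hq'
  set B := ev (∏ j, (1 + Polynomial.C (b j - 1) * Polynomial.X)) with hB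
  rw [key b] at hQ
  have hsplit : (∏ i, (1 + C (a i) * X)) * Q = (1 + X) ^ n * ev (f * h) -
      X ^ (n + 2) * ((1 + X) ^ k * ev f * Q * u ^ (n + 2) * ev q) := by
    have hk : (1 + X : R⟦X⟧) ^ k = (1 + X) ^ l * (1 + X) ^ n := by rw [hn, pow_add]
    rw [key a, hk, map_mul]
    rw [mul_pow] at hq'
    linear_combination (1 + X) ^ n * ev f * ev h * hQ -
      (1 + X) ^ n * (1 + X) ^ l * ev f * Q * hq'
  rw [hsplit, map_sub]
  refine sub_mem ?_ ?_
  · have hev : ev (f * h) = ∑ d ∈ (f * h).support, C ((f * h).coeff d) * (X * u) ^ d := by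
      change Polynomial.aeval _ _ = _
      rw [Polynomial.aeval_def, Polynomial.eval₂_eq_sum, Polynomial.sum_def]
      rfl
    rw [hev, Finset.mul_sum, map_sum]
    refine sum_mem fun d _ => ?_
    -- The term is a multiple of `X ^ d (1 + X) ^ (n - d)`: for `d ≤ n` a polynomial of degree at
    -- most `n`, for `d > n + 1` divisible by too high a power of `X`. Only `d = n + 1` contributes.
    rcases lt_trichotomy d (n + 1) with hk | hk | hk
    · obtain ⟨e, rfl⟩ := Nat.exists_eq_add_of_le (Nat.lt_succ_iff.1 hk)
      have h1 : (1 + X : R⟦X⟧) ^ (d + e) * (C ((f * h).coeff d) * (X * u) ^ d) =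
          C ((f * h).coeff d) *
            ((Polynomial.X ^ d * (1 + Polynomial.X) ^ e : Polynomial R) : R⟦X⟧) := by
        have : (1 + X : R⟦X⟧) ^ d * u ^ d = 1 := by rw [← mul_pow, hu, one_pow]
        push_cast
        rw [pow_add, mul_pow]
        linear_combination (C ((f * h).coeff d) * X ^ d * (1 + X) ^ e) * this
      rw [h1, coeff_C_mul, Polynomial.coeff_coe, Polynomial.coeff_eq_zero_of_natDegree_lt (n := d + e + 1), mul_zero]
      · exact zero_mem _
      · refine lt_of_le_of_lt ?_ (Nat.lt_succ_self _)
        refine Polynomial.natDegree_mul_le.trans (add_le_add ?_ ?_)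
        · exact Polynomial.natDegree_X_pow_le d
        · refine (Polynomial.natDegree_pow_le).trans ?_
          have : (1 + Polynomial.X : Polynomial R).natDegree ≤ 1 :=
            (Polynomial.natDegree_add_le _ _).trans (by simp [Polynomial.natDegree_X_le])
          nlinarith
    · subst hk
      have := (mem_reesAlgebra_iff _ _).1 hfh (n + 1)
      rw [show (1 + X : R⟦X⟧) ^ n * (C ((f * h).coeff (n + 1)) * (X * u) ^ (n + 1)) =
        C ((f * h).coeff (n + 1)) * ((1 + X : R⟦X⟧) ^ n * (X * u) ^ (n + 1)) by ring, coeff_C_mul]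
      exact Ideal.mul_mem_right _ _ this
    · rw [mul_pow, show (1 + X : R⟦X⟧) ^ n * (C ((f * h).coeff d) * (X ^ d * u ^ d)) =
        X ^ d * ((1 + X : R⟦X⟧) ^ n * C ((f * h).coeff d) * u ^ d) by ring,
        coeff_X_pow_mul', if_neg (by omega)]
      exact zero_mem _
  · rw [coeff_X_pow_mul', if_neg (by omega)]
    exact zero_mem _

end Algebra

/-! ### Diagonalization of representations of finite abelian groups. -/

section Eigenbasis

/-- The class in `R(G)` of a linear character. -/
noncomputable def linChar {G : Type*} [Group G] (χ : G →* ℂ) : VirtualChar G :=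
  ofRep (FDRep.of (V := ℂ) ((Algebra.lmul ℂ ℂ).toMonoidHom.comp χ : Representation ℂ G ℂ))

theorem linChar_apply {G : Type*} [Group G] (χ : G →* ℂ) (g : G) :
    (linChar χ : G → ℂ) g = χ g := by
  change LinearMap.trace ℂ ℂ (LinearMap.mul ℂ ℂ (χ g)) = χ g
  rw [LinearMap.trace_eq_matrix_trace ℂ (Module.Basis.singleton Unit ℂ)]
  simp [Matrix.trace, LinearMap.toMatrix_apply]

theorem trace_of_monomial {E κ : Type*} [AddCommGroup E] [Module ℂ E] [Fintype κ] [DecidableEq κ]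
    (b : Module.Basis κ ℂ E) (f : E →ₗ[ℂ] E) (c : κ → ℂ) (e : κ → κ)
    (h : ∀ j, f (b j) = c j • b (e j)) :
    LinearMap.trace ℂ E f = ∑ j, if e j = j then c j else 0 := by
  rw [LinearMap.trace_eq_matrix_trace ℂ b, Matrix.trace]
  refine Finset.sum_congr rfl fun j _ => ?_
  rw [Matrix.diag_apply, LinearMap.toMatrix_apply, h, map_smul, Module.Basis.repr_self]
  simp [Finsupp.single_apply]

theorem trace_of_diagonal {E κ : Type*} [AddCommGroup E] [Module ℂ E] [Fintype κ]
    (b : Module.Basis κ ℂ E) (f : E →ₗ[ℂ] E) (c : κ → ℂ) (h : ∀ j, f (b j) = c j • b j) :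
    LinearMap.trace ℂ E f = ∑ j, c j := by
  classical
  simpa using trace_of_monomial b f c id h

/-- A basis of simultaneous eigenvectors for a representation. -/
structure Eigenbasis {G : Type*} [Group G] (V : FDRep ℂ G) where
  dim : ℕ
  basis : Module.Basis (Fin dim) ℂ V
  char : Fin dim → G →* ℂ
  act_basis : ∀ i g, act V g (basis i) = char i g • basis i

/-- Fourier inversion: by orthogonality of characters every `v` is the average over `ψ` of the
vectors `∑ g, ψ(g) g v`, each of which is zero or a simultaneous eigenvector. So eigenvectors span,
and a basis can be chosen among them. -/
theorem nonempty_eigenbasis {G : Type*} [CommGroup G] [Finite G] (V : FDRep ℂ G) :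
    Nonempty (Eigenbasis V) := by
  classical
  have := Fintype.ofFinite G
  let s : Set V := {v | ∃ χ : G →* ℂ, ∀ g, act V g v = χ g • v}
  have hs : ⊤ ≤ Submodule.span ℂ s := by
    intro v _
    have hsum : ∑ ψ : AddChar (Additive G) ℂ, ∑ g : G, ψ (Additive.ofMul g) • act V g v =
        (Fintype.card G : ℂ) • v := by
      rw [Finset.sum_comm]
      simp_rw [← Finset.sum_smul, AddChar.sum_apply_eq_ite]
      rw [Finset.sum_eq_single 1]
      · simp
      · intro g _ hg
        rw [if_neg (by simpa using hg), zero_smul]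
      · simp
    have hv : v = (Fintype.card G : ℂ)⁻¹ •
        ∑ ψ : AddChar (Additive G) ℂ, ∑ g : G, ψ (Additive.ofMul g) • act V g v := by
      rw [hsum, smul_smul, inv_mul_cancel₀ (by simp), one_smul]
    rw [hv]
    refine Submodule.smul_mem _ _ (sum_mem fun ψ _ => Submodule.subset_span ?_)
    -- Substituting `g ↦ h g` shows that `h` acts on the `ψ`-sum by `ψ(h⁻¹)`.
    refine ⟨⟨⟨fun g => ψ (-Additive.ofMul g), by simp⟩, fun g h => by
      change ψ (-Additive.ofMul (g * h)) = ψ (-Additive.ofMul g) * ψ (-Additive.ofMul h)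
      rw [ofMul_mul, neg_add, AddChar.map_add_eq_mul]⟩, fun h => ?_⟩
    rw [map_sum, Finset.smul_sum]
    refine Fintype.sum_equiv (Equiv.mulLeft h) _ _ fun g => ?_
    change _ = ψ (-Additive.ofMul h) • ψ (Additive.ofMul (h * g)) • act V (h * g) v
    rw [map_smul, smul_smul, ← AddChar.map_add_eq_mul, ofMul_mul, neg_add_cancel_left, map_mul,
      Module.End.mul_apply]
  let b₀ := Module.Basis.ofSpan hs
  have := Module.Finite.finite_basis b₀
  let b := b₀.reindex (Finite.equivFin _)
  have hb : ∀ i, b i ∈ s := fun i => by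
    rw [Module.Basis.reindex_apply]
    exact Module.Basis.ofSpan_subset hs ⟨_, rfl⟩
  choose χ hχ using hb
  exact ⟨⟨_, b, χ, hχ⟩⟩

theorem Eigenbasis.character {G : Type*} [Group G] {V : FDRep ℂ G} (e : Eigenbasis V) (g : G) :
    (act V).character g = ∑ i, e.char i g :=
  trace_of_diagonal e.basis _ _ fun i => e.act_basis i g

theorem Eigenbasis.ofRep_eq {G : Type*} [Group G] {V : FDRep ℂ G} (e : Eigenbasis V) :
    ofRep V = ∑ i, linChar (e.char i) := by
  apply Subtype.ext
  funext g
  rw [AddSubmonoidClass.coe_finsetSum, Finset.sum_apply]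
  simp_rw [linChar_apply]
  exact e.character g

theorem Eigenbasis.finrank_eq {G : Type*} [Group G] {V : FDRep ℂ G} (e : Eigenbasis V) :
    Module.finrank ℂ V = e.dim := by
  rw [Module.finrank_eq_card_basis e.basis, Fintype.card_fin]

/-- Wedges of eigenvectors are eigenvectors for the product characters, so exterior powers become
elementary symmetric functions and `λ_t` a product of linear factors. -/
theorem Eigenbasis.ofRep_extPow {G : Type*} [Group G] {V : FDRep ℂ G} (e : Eigenbasis V) (n : ℕ) :
    ofRep (extPow n V) = ∑ s ∈ Finset.powersetCard n Finset.univ, ∏ i ∈ s, linChar (e.char i) := by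
  apply Subtype.ext
  funext g
  have h := trace_of_diagonal (e.basis.exteriorPower n) (exteriorPower.map n (act V g))
    (fun s => ∏ i ∈ (s : Finset (Fin e.dim)), e.char i g) (by
      intro s
      rw [exteriorPower.coe_basis, exteriorPower.map_apply_ιMulti_family]
      have h1 : (act V g : V → V) ∘ e.basis = fun i => e.char i g • e.basis i :=
        funext fun i => e.act_basis i g
      rw [h1]
      unfold exteriorPower.ιMulti_family
      have h2 := (exteriorPower.ιMulti ℂ n (M := V)).map_smul_univ
        (fun i => e.char (Set.powersetCard.ofFinEmbEquiv.symm s i) g)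
        (fun i => e.basis (Set.powersetCard.ofFinEmbEquiv.symm s i))
      refine h2.trans ?_
      congr 1
      rw [← Finset.map_orderEmbOfFin_univ (s : Finset (Fin e.dim)) s.2, Finset.prod_map]
      rfl)
  refine Eq.trans h ?_
  rw [AddSubmonoidClass.coe_finsetSum, Finset.sum_apply]
  simp_rw [SubmonoidClass.coe_finsetProd, Finset.prod_apply, linChar_apply]
  exact (Finset.sum_subtype (p := (· ∈ Set.powersetCard (Fin e.dim) n))
    (Finset.powersetCard n Finset.univ)
    (fun s => by rw [Finset.mem_powersetCard_univ]; rfl) fun s => ∏ i ∈ s, e.char i g).symm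

open PowerSeries in
theorem coeff_prod_one_add_C_mul_X {R ι : Type*} [CommRing R] [Fintype ι] (a : ι → R) (n : ℕ) :
    coeff n (∏ i, (1 + C (a i) * X)) =
      ∑ s ∈ Finset.powersetCard n Finset.univ, ∏ i ∈ s, a i := by
  classical
  rw [Finset.prod_one_add, map_sum, Finset.powersetCard_eq_filter, Finset.sum_filter]
  refine Finset.sum_congr rfl fun s _ => ?_
  rw [Finset.prod_mul_distrib, Finset.prod_const, ← map_prod, coeff_C_mul, coeff_X_pow]
  simp [eq_comm]

open PowerSeries in
theorem Eigenbasis.lambdaSeries_eq {G : Type*} [Group G] {V : FDRep ℂ G} (e : Eigenbasis V) :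
    lambdaSeries V = ∏ i, (1 + C (linChar (e.char i)) * X) := by
  ext1 n
  rw [coeff_prod_one_add_C_mul_X, ← e.ofRep_extPow]
  exact coeff_mk _ _

end Eigenbasis
-- The Grothendieck filtration equals the augmentation filtration.
section Filtration

theorem mem_augIdeal_iff {G : Type*} [Group G] {x : VirtualChar G} :
    x ∈ augIdeal G ↔ (x : G → ℂ) 1 = 0 := Iff.rfl

theorem linChar_sub_one_mem {G : Type*} [Group G] (χ : G →* ℂ) :
    linChar χ - 1 ∈ augIdeal G := by
  rw [mem_augIdeal_iff]
  change (linChar χ : G → ℂ) 1 - 1 = 0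
  rw [linChar_apply, map_one, sub_self]

theorem Eigenbasis.constantCoeff_lambdaSeries {G : Type*} [Group G] {V : FDRep ℂ G} (e : Eigenbasis V) :
    PowerSeries.constantCoeff (lambdaSeries V) = 1 := by
  rw [e.lambdaSeries_eq, map_prod]
  simp

theorem Eigenbasis.coeff_one_lambdaSeries {G : Type*} [Group G] {V : FDRep ℂ G} (e : Eigenbasis V) :
    PowerSeries.coeff 1 (lambdaSeries V) = ofRep V := by
  rw [e.lambdaSeries_eq, coeff_prod_one_add_C_mul_X, e.ofRep_eq, Finset.powersetCard_one,
    Finset.sum_map]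
  simp

theorem Gam_anti {G : Type*} [Group G] {m n : ℕ} (h : m ≤ n) : Gam G n ≤ Gam G m :=
  AddSubgroup.closure_mono fun _ ⟨l, hl, hx⟩ => ⟨l, h.trans hl, hx⟩

variable {G : Type*} [CommGroup G] [Finite G]

theorem gammaOp_mem {x : VirtualChar G} (hx : x ∈ augIdeal G) (n : ℕ) :
    gammaOp n x ∈ augIdeal G ^ n := by
  obtain _ | n := n
  · simp
  obtain ⟨e⟩ := nonempty_eigenbasis (posPart (x + ((n + 1 : ℕ) : VirtualChar G) - 1))
  obtain ⟨e'⟩ := nonempty_eigenbasis (negPart (x + ((n + 1 : ℕ) : VirtualChar G) - 1))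
  -- Here `γⁿ⁺¹(x) = λⁿ⁺¹(x + n)` and `x` has degree zero, so any presentation of `x + n` has excess
  -- dimension exactly `n`.
  have hdim : e.dim = e'.dim + n := by
    have h := congrArg (augmentation G) (posPart_sub_negPart (x + ((n + 1 : ℕ) : VirtualChar G) - 1))
    rw [map_sub, augmentation_ofRep, augmentation_ofRep, e.finrank_eq, e'.finrank_eq, map_sub,
      map_add, (RingHom.mem_ker.1 hx : augmentation G x = 0), map_natCast, map_one] at h
    push_cast at h
    have : (e.dim : ℂ) = (e'.dim + n : ℕ) := by push_cast; linear_combination h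
    exact_mod_cast this
  unfold gammaOp lambdaOp
  rw [e.lambdaSeries_eq]
  refine coeff_prod_mul_inverse_mem _ _ _ (fun i => linChar_sub_one_mem (e.char i))
    (fun i => linChar_sub_one_mem (e'.char i)) hdim _ ?_
  rw [← e'.lambdaSeries_eq]
  exact PowerSeries.mul_invOfUnit _ _ e'.constantCoeff_lambdaSeries

theorem lambdaOp_one (x : VirtualChar G) : lambdaOp 1 x = x := by
  obtain ⟨e⟩ := nonempty_eigenbasis (posPart x)
  obtain ⟨e'⟩ := nonempty_eigenbasis (negPart x)
  have h := PowerSeries.mul_invOfUnit _ 1 e'.constantCoeff_lambdaSeries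
  have h1 := congrArg (PowerSeries.coeff 1) h
  unfold lambdaOp
  rw [PowerSeries.coeff_mul, Finset.Nat.sum_antidiagonal_eq_sum_range_succ_mk] at h1 ⊢
  simp [Finset.sum_range_succ, e.constantCoeff_lambdaSeries, e'.constantCoeff_lambdaSeries,
    e.coeff_one_lambdaSeries, e'.coeff_one_lambdaSeries, PowerSeries.coeff_one] at h1 ⊢
  rw [eq_neg_of_add_eq_zero_left h1, neg_add_eq_sub, posPart_sub_negPart]

theorem gammaOp_one (x : VirtualChar G) : gammaOp 1 x = x := by
  rw [gammaOp, lambdaOp_one]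
  simp

/-- A virtual character of a finite abelian group is a difference of sums of linear characters. -/
theorem exists_eq_sum_linChar_sub (x : VirtualChar G) : ∃ (k l : ℕ) (χ : Fin k → G →* ℂ)
    (ψ : Fin l → G →* ℂ), x = ∑ i, linChar (χ i) - ∑ j, linChar (ψ j) := by
  obtain ⟨e⟩ := nonempty_eigenbasis (posPart x)
  obtain ⟨e'⟩ := nonempty_eigenbasis (negPart x)
  exact ⟨_, _, e.char, e'.char, by rw [← e.ofRep_eq, ← e'.ofRep_eq, posPart_sub_negPart]⟩

theorem linChar_induction {P : VirtualChar G → Prop} (hchar : ∀ χ, P (linChar χ))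
    (hsub : ∀ x y, P x → P y → P (x - y)) (x : VirtualChar G) : P x := by
  have h0 : P 0 := by simpa using hsub _ _ (hchar 1) (hchar 1)
  have hadd : ∀ x y, P x → P y → P (x + y) := fun x y hx hy => by
    simpa using hsub _ _ hx (hsub _ _ h0 hy)
  obtain ⟨k, l, χ, ψ, rfl⟩ := exists_eq_sum_linChar_sub x
  exact hsub _ _ (Finset.sum_induction _ P hadd h0 fun i _ => hchar _)
    (Finset.sum_induction _ P hadd h0 fun i _ => hchar _)

/-- Degree zero forces equally many positive and negative linear characters, so a `1` can be
subtracted from each. Closure under differences already yields `0` and sums. -/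
theorem augIdeal_induction {P : VirtualChar G → Prop} (hchar : ∀ χ, P (linChar χ - 1))
    (hsub : ∀ x y, P x → P y → P (x - y)) {x : VirtualChar G} (hx : x ∈ augIdeal G) : P x := by
  have h0 : P 0 := by simpa using hsub _ _ (hchar 1) (hchar 1)
  have hadd : ∀ x y, P x → P y → P (x + y) := fun x y hx hy => by
    simpa using hsub _ _ hx (hsub _ _ h0 hy)
  obtain ⟨k, l, χ, ψ, rfl⟩ := exists_eq_sum_linChar_sub x
  have hkl : k = l := by
    have h := RingHom.mem_ker.1 hx
    have haug : ∀ χ : G →* ℂ, augmentation G (linChar χ) = 1 := fun χ =>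
      (linChar_apply χ 1).trans (map_one χ)
    simp only [map_sub, map_sum, haug] at h
    simpa [sub_eq_zero] using h
  subst hkl
  have : ∑ i, linChar (χ i) - ∑ j, linChar (ψ j) =
      ∑ i, (linChar (χ i) - 1) - ∑ j, (linChar (ψ j) - 1) := by
    simp only [Finset.sum_sub_distrib]
    ring
  rw [this]
  exact hsub _ _ (Finset.sum_induction _ P hadd h0 fun i _ => hchar _)
    (Finset.sum_induction _ P hadd h0 fun i _ => hchar _)

theorem augIdeal_le_Gam_one {x : VirtualChar G} (hx : x ∈ augIdeal G) : x ∈ Gam G 1 :=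
  AddSubgroup.subset_closure ⟨[(1, ⟨x, hx⟩)], by simp, by simp [gammaOp_one]⟩

/-- For a finite abelian group, the Grothendieck filtration is the augmentation filtration. -/
theorem mem_Gam_iff {n : ℕ} {x : VirtualChar G} : x ∈ Gam G n ↔ x ∈ augIdeal G ^ n := by
  constructor
  · intro hx
    have : Gam G n ≤ (augIdeal G ^ n).toAddSubgroup := by
      refine (AddSubgroup.closure_le _).2 ?_
      rintro _ ⟨l, hl, rfl⟩
      refine Ideal.pow_le_pow_right hl ?_
      clear hl
      induction l with
      | nil => simp
      | cons a l ih =>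
        rw [List.map_cons, List.map_cons, List.prod_cons, List.sum_cons, pow_add]
        exact Ideal.mul_mem_mul (gammaOp_mem a.2.2 _) ih
    exact this hx
  · intro hx
    induction n generalizing x with
    | zero =>
      -- That `Γ⁰` is the whole ring follows from `χ = (χ - 1) + 1`.
      refine linChar_induction (P := (· ∈ Gam G 0)) (fun χ => ?_) (fun x y => sub_mem) x
      have := Gam_anti zero_le_one (augIdeal_le_Gam_one (linChar_sub_one_mem χ))
      simpa using add_mem this (one_mem_Gam G)
    | succ n ih =>
      rw [pow_succ] at hx
      exact Submodule.mul_induction_on hx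
        (fun a ha b hb => Gam_mul (ih ha) (augIdeal_le_Gam_one hb)) fun a b => add_mem

end Filtration
-- Character values of tensor induction.
section Norm

theorem veeInv_of_pow {L X : Type*} (a : L → Finset X → ℂ) (g : L) (w : ℂ)
    (ha : ∀ D, a g D = w ^ D.card) (D : Finset X) : veeInv a g D = (-w) ^ D.card := by
  classical
  induction D using Finset.strongInduction with
  | H D ih =>
  rw [veeInv]
  split_ifs with h
  · simp [h]
  · rw [neg_eq_iff_add_eq_zero]
    rw [Finset.sum_congr rfl fun E _ => by
      rw [ih E.1 (Finset.mem_ssubsets.1 E.2), ha],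
      Finset.sum_attach _ fun E => w ^ (D \ E).card * (-w) ^ E.card]
    have h1 := Finset.sum_pow_mul_eq_add_pow (-w) w D
    rw [neg_add_cancel, zero_pow (by simpa using h),
      ← Finset.insert_erase (Finset.mem_powerset_self D), Finset.sum_insert (by simp)] at h1
    rw [← h1, add_comm]
    congr 1
    · simp
    · refine Finset.sum_congr ?_ fun E hE => ?_
      · ext E
        simp [Finset.ssubset_iff_subset_ne, and_comm]
      · have hE' := Finset.mem_powerset.1 (Finset.mem_of_mem_erase hE)
        rw [mul_comm, ← Finset.card_sdiff_of_subset hE']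

theorem vee_veeInv_of_pow {L X : Type*} (a b : L → Finset X → ℂ) (g : L) (v w : ℂ)
    (ha : ∀ D, a g D = v ^ D.card) (hb : ∀ D, b g D = w ^ D.card) (D : Finset X) :
    vee a (veeInv b) g D = (v - w) ^ D.card := by
  classical
  rw [sub_eq_add_neg, ← Finset.sum_pow_mul_eq_add_pow]
  unfold vee
  refine Finset.sum_congr rfl fun E hE => ?_
  rw [ha, veeInv_of_pow b g w hb]
  congr 2
  convert Finset.card_sdiff_of_subset (Finset.mem_powerset.1 hE)

/-- With no trace on proper nonempty subsets, both the recursion for the inverse and the final sum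
reduce to the terms at `∅` and the whole set. -/
theorem vee_veeInv_univ_of_support {L X : Type*} [Fintype X] [Nonempty X]
    (a b : L → Finset X → ℂ) (g : L)
    (ha₀ : a g ∅ = 1) (ha : ∀ D : Finset X, D.Nonempty → D ≠ Finset.univ → a g D = 0)
    (hb : ∀ D : Finset X, D.Nonempty → D ≠ Finset.univ → b g D = 0) :
    vee a (veeInv b) g Finset.univ = a g Finset.univ - b g Finset.univ := by
  classical
  have hne : (∅ : Finset X) ≠ Finset.univ := Finset.univ_nonempty.ne_empty.symm
  have hinv : veeInv b g Finset.univ = - b g Finset.univ := by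
    rw [veeInv, if_neg hne.symm]
    congr 1
    rw [Finset.sum_attach _ fun E => b g (Finset.univ \ E) * veeInv b g E]
    rw [Finset.sum_eq_single ∅]
    · rw [veeInv, if_pos rfl, mul_one]
      congr 1
      convert Finset.sdiff_empty
    · intro E hE hE0
      rw [hb, zero_mul]
      · have := (Finset.mem_ssubsets.1 hE).2
        rw [Finset.sdiff_nonempty]
        exact this
      · intro h
        apply hE0
        refine Finset.eq_empty_of_forall_notMem fun x hx => ?_
        exact (Finset.mem_sdiff.1 (h ▸ Finset.mem_univ x)).2 hx
    · intro h
      exact absurd (Finset.mem_ssubsets.2 (Finset.empty_ssubset.2 Finset.univ_nonempty)) h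
  unfold vee
  rw [← Finset.sum_subset (s₁ := {∅, Finset.univ}) (by simp)]
  · rw [Finset.sum_pair hne, ha₀, Finset.sdiff_empty, hinv]
    have : veeInv b g ∅ = 1 := by rw [veeInv, if_pos rfl]
    rw [Finset.sdiff_self, this]
    ring
  · intro D _ hD
    rw [Finset.mem_insert, Finset.mem_singleton, not_or] at hD
    rw [ha D (Finset.nonempty_iff_ne_empty.2 hD.1) hD.2, zero_mul]

open Classical in
-- In the tensor basis of eigenvectors `g` acts by a monomial matrix, so only basis tensors it
-- permutes to themselves contribute to the trace.
theorem tensorRep_character {H K : Type*} [Group H] [Group K] (i : H →* K)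
    (hi : Function.Injective i) {V : FDRep ℂ H} (e : Eigenbasis V) (D : Finset (K ⧸ i.range))
    (g : MulAction.stabilizer K (D : Set (K ⧸ i.range))) :
    (tensorRep i hi V D).character g = ∑ f : D → Fin e.dim,
      if f ∘ (stabPerm i D g).symm = f then
        ∏ c, e.char (f c) (cosetShift i hi (g : K) c) else 0 := by
  classical
  refine (trace_of_monomial (Basis.piTensorProduct fun _ : D => e.basis) (tensorAct i hi V D g)
    (fun f => ∏ c, e.char (f ((stabPerm i D g).symm c)) (cosetShift i hi (g : K) c))
    (fun f => f ∘ (stabPerm i D g).symm) fun f => ?_).trans ?_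
  · rw [Basis.piTensorProduct_apply, tensorAct_tprod, Basis.piTensorProduct_apply,
      ← MultilinearMap.map_smul_univ]
    simp_rw [e.act_basis]
    rfl
  · refine Finset.sum_congr rfl fun f _ => ?_
    split_ifs with h
    · refine Finset.prod_congr rfl fun c _ => ?_
      rw [show f ((stabPerm i D g).symm c) = f c from congrFun h c]
    · rfl

variable {H K : Type*} [CommGroup H] [CommGroup K] (i : H →* K) (hi : Function.Injective i)

theorem inv_smul_of_mem_range (h : H) (c : K ⧸ i.range) : (i h)⁻¹ • c = c := by
  obtain ⟨k, rfl⟩ := QuotientGroup.mk_surjective c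
  rw [MulAction.Quotient.smul_mk, QuotientGroup.eq]
  exact ⟨h, by simp [mul_comm]⟩

theorem cosetShift_of_mem_range (h : H) (c : K ⧸ i.range) : cosetShift i hi (i h) c = h := by
  apply hi
  rw [map_cosetShift, inv_smul_of_mem_range, mul_comm, mul_inv_cancel_left]

theorem chiRep_of_mem_range [Finite H] (V : FDRep ℂ H) (h : H) (D : Finset (K ⧸ i.range)) :
    chiRep i hi V (i h) D = (act V).character h ^ D.card := by
  classical
  obtain ⟨e⟩ := nonempty_eigenbasis V
  have hmem : i h ∈ MulAction.stabilizer K (D : Set (K ⧸ i.range)) := by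
    rw [MulAction.mem_stabilizer_set]
    intro c
    rw [← inv_smul_of_mem_range i h (i h • c), inv_smul_smul]
  rw [chiRep, dif_pos hmem, tensorRep_character i hi e, e.character]
  have hperm : ∀ c, (stabPerm i D ⟨i h, hmem⟩).symm c = c := fun c =>
    Subtype.ext (by rw [stabPerm_symm_coe]; exact inv_smul_of_mem_range i h c)
  simp_rw [cosetShift_of_mem_range]
  rw [← Fintype.card_coe, ← Finset.card_univ, ← Finset.prod_const, Finset.prod_univ_sum]
  simp [funext_iff, hperm]

/-- This is the transfer of `g`: in a commutative group the coset representatives cancel after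
reindexing by `g⁻¹`. -/
theorem prod_cosetShift [Fintype (K ⧸ i.range)] (g : K) :
    i (∏ c, cosetShift i hi g c) = g ^ i.range.index := by
  rw [map_prod]
  simp_rw [map_cosetShift]
  rw [Finset.prod_mul_distrib, Finset.prod_mul_distrib, Finset.prod_const, Finset.card_univ,
    ← Nat.card_eq_fintype_card]
  have h := Equiv.prod_comp (MulAction.toPerm g⁻¹) fun c : K ⧸ i.range => c.out
  simp only [MulAction.toPerm_apply] at h
  rw [h, Finset.prod_inv_distrib, mul_comm, mul_inv_cancel_left]
  rfl

/-- The quotient has prime order, so the class of `g⁻¹` generates it and acts transitively. -/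
theorem eq_of_invariant (hp : i.range.index.Prime) {g : K} (hg : g ∉ i.range) {α : Type*}
    (F : K ⧸ i.range → α) (hF : ∀ c, F (g⁻¹ • c) = F c) (c d : K ⧸ i.range) : F c = F d := by
  have := Fact.mk hp
  have hg' : ((g⁻¹ : K) : K ⧸ i.range) ≠ 1 := by
    rwa [Ne, QuotientGroup.eq_one_iff, inv_mem_iff]
  have key : ∀ c, F c = F 1 := by
    intro c
    obtain ⟨n, rfl⟩ := mem_powers_of_prime_card (G := K ⧸ i.range) (p := i.range.index) rfl hg'
      (g' := c)
    induction n with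
    | zero => simp
    | succ n ih =>
      rw [← ih, ← hF (_ ^ n)]
      dsimp only
      rw [pow_succ']
      rfl
  rw [key c, key d]

theorem chiRep_empty {H K : Type*} [Group H] [Group K] (i : H →* K)
    (hi : Function.Injective i) {V : FDRep ℂ H} (e : Eigenbasis V) (g : K) :
    chiRep i hi V g ∅ = 1 := by
  rw [chiRep, dif_pos (by simp), tensorRep_character i hi e,
    Fintype.sum_unique, if_pos (Subsingleton.elim _ _)]
  simp

theorem chiRep_eq_zero (hp : i.range.index.Prime) {g : K} (hg : g ∉ i.range) (V : FDRep ℂ H)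
    {D : Finset (K ⧸ i.range)} (hD : D.Nonempty) (hD' : ∃ c, c ∉ D) :
    chiRep i hi V g D = 0 := by
  rw [chiRep, dif_neg]
  intro h
  obtain ⟨c, hc⟩ := hD
  obtain ⟨d, hd⟩ := hD'
  apply hd
  rw [← eq_of_invariant i hp hg (· ∈ D) (fun x => ?_) c d]
  · exact hc
  · have h1 := MulAction.mem_stabilizer_set.1 h (g⁻¹ • x)
    rw [smul_inv_smul] at h1
    exact propext h1.symm

theorem chiRep_univ [Finite H] [Fintype (K ⧸ i.range)] (hp : i.range.index.Prime) {g : K}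
    (hg : g ∉ i.range) {h : H} (hh : i h = g ^ i.range.index) (V : FDRep ℂ H) :
    chiRep i hi V g Finset.univ = (act V).character h := by
  classical
  obtain ⟨e⟩ := nonempty_eigenbasis V
  rw [chiRep, dif_pos (by simp), tensorRep_character i hi e, e.character]
  have hh' : h = ∏ c, cosetShift i hi g c := hi (by rw [hh, prod_cosetShift])
  symm
  -- Transitivity leaves only the constant functions `f`; the constant `j` contributes the `j`-th
  -- character at the transfer of `g`, which is `h`.
  refine Finset.sum_of_injOn (fun j _ => j) ?_ (by simp) ?_ ?_
  · intro a _ b _ hab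
    exact congrFun hab ⟨1, Finset.mem_univ _⟩
  · intro f _ hf
    rw [if_neg]
    intro hinv
    apply hf
    refine ⟨f ⟨1, Finset.mem_univ _⟩, by simp, ?_⟩
    funext c
    refine (eq_of_invariant i hp hg (fun c => f ⟨c, Finset.mem_univ _⟩) (fun x => ?_) c.1 1).symm
    have := congrFun hinv ⟨x, Finset.mem_univ _⟩
    rw [← this, Function.comp_apply]
    congr 1
  · intro j _
    rw [if_pos, hh', map_prod]
    swap
    · rfl
    exact (Finset.prod_coe_sort Finset.univ fun c => e.char j (cosetShift i hi g c)).symm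

theorem character_posPart_sub (x : VirtualChar H) (h : H) :
    (act (posPart x)).character h - (act (negPart x)).character h = (x : H → ℂ) h :=
  congrArg (fun y : VirtualChar H => (y : H → ℂ) h) (posPart_sub_negPart x)

variable [Finite K]

theorem tensorNorm_of_mem_range [Finite H] (x : VirtualChar H) (h : H) :
    tensorNorm i hi x (i h) = (x : H → ℂ) h ^ i.range.index := by
  unfold tensorNorm
  rw [vee_veeInv_of_pow _ _ _ _ _ (chiRep_of_mem_range i hi _ h) (chiRep_of_mem_range i hi _ h),
    character_posPart_sub, @Finset.card_univ _ (Fintype.ofFinite _),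
    ← @Nat.card_eq_fintype_card _ (Fintype.ofFinite _)]
  rfl

theorem tensorNorm_of_notMem_range [Finite H] (hp : i.range.index.Prime) (x : VirtualChar H) {g : K}
    (hg : g ∉ i.range) {h : H} (hh : i h = g ^ i.range.index) :
    tensorNorm i hi x g = (x : H → ℂ) h := by
  obtain ⟨e⟩ := nonempty_eigenbasis (posPart x)
  have hne : ∀ D : Finset (K ⧸ i.range), D ≠ @Finset.univ _ (Fintype.ofFinite _) →
      ∃ c, c ∉ D := by
    intro D hD
    by_contra! hc
    exact hD (by ext c; simp [hc c])
  unfold tensorNorm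
  rw [@vee_veeInv_univ_of_support _ _ (Fintype.ofFinite _) _ _ _ _ (chiRep_empty i hi e g)
    (fun D hD hD' => chiRep_eq_zero i hi hp hg _ hD (hne D hD'))
    (fun D hD hD' => chiRep_eq_zero i hi hp hg _ hD (hne D hD')),
    @chiRep_univ _ _ _ _ i hi _ (Fintype.ofFinite _) hp g hg h hh,
    @chiRep_univ _ _ _ _ i hi _ (Fintype.ofFinite _) hp g hg h hh, character_posPart_sub]

end Norm
-- Restriction along homomorphisms, and faithfulness of a generating character.
section Pullback

theorem exists_ofRep_eq_linChar {G : Type*} [CommGroup G] [Finite G] {V : FDRep ℂ G}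
    (hV : Module.finrank ℂ V = 1) : ∃ χ : G →* ℂ, ofRep V = linChar χ := by
  obtain ⟨e⟩ := nonempty_eigenbasis V
  have h := e.ofRep_eq
  have hd : e.dim = 1 := e.finrank_eq.symm.trans hV
  have : Unique (Fin e.dim) := hd ▸ inferInstanceAs (Unique (Fin 1))
  exact ⟨_, h.trans (Fintype.sum_unique _)⟩

/-- The restriction of virtual characters along a group homomorphism. -/
noncomputable def pullChar {G H : Type*} [Group G] [Group H] (f : G →* H) :
    VirtualChar H →+* VirtualChar G where
  toFun x := ⟨fun g => (x : H → ℂ) (f g), by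
    obtain ⟨_, V, W, rfl⟩ := x
    exact ⟨pullback f V, pullback f W, rfl⟩⟩
  map_one' := rfl
  map_mul' _ _ := rfl
  map_zero' := rfl
  map_add' _ _ := rfl

theorem pullChar_apply {G H : Type*} [Group G] [Group H] (f : G →* H) (x : VirtualChar H) (g : G) :
    (pullChar f x : G → ℂ) g = (x : H → ℂ) (f g) := rfl

theorem ofRep_pullback {G H : Type*} [Group G] [Group H] (f : G →* H) (V : FDRep ℂ H) :
    ofRep (pullback f V) = pullChar f (ofRep V) := rfl

theorem pullChar_mem {G H : Type*} [Group G] [Group H] (f : G →* H) {n : ℕ} {x : VirtualChar H}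
    (hx : x ∈ augIdeal H ^ n) : pullChar f x ∈ augIdeal G ^ n := by
  have h1 : (augIdeal H).map (pullChar f) ≤ augIdeal G := by
    rw [Ideal.map_le_iff_le_comap]
    intro y hy
    rw [Ideal.mem_comap, mem_augIdeal_iff, pullChar_apply, map_one]
    exact hy
  have h2 := Ideal.mem_map_of_mem (pullChar f) hx
  rw [Ideal.map_pow] at h2
  exact Ideal.pow_right_mono h1 n h2

/-- If `ψ(c) = 1`, every virtual character would agree at `c` and `1`, whereas linear characters
separate points. -/
theorem apply_ne_one_of_closure_eq_top {C : Type*} [CommGroup C] [Finite C] {ψ : C →* ℂ}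
    (hgen : Subring.closure {linChar ψ} = ⊤) {c : C} (hc : c ≠ 1) : ψ c ≠ 1 := by
  intro h
  have key : ∀ x : VirtualChar C, (x : C → ℂ) c = (x : C → ℂ) 1 := by
    intro x
    have hx : x ∈ Subring.closure {linChar ψ} := hgen ▸ Subring.mem_top x
    induction hx using Subring.closure_induction with
    | mem x hx =>
      rw [Set.mem_singleton_iff.1 hx, linChar_apply, linChar_apply, h, map_one]
    | zero => rfl
    | one => rfl
    | add x y _ _ hx hy => exact congrArg₂ (· + ·) hx hy
    | neg x _ hx => exact congrArg (- ·) hx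
    | mul x y _ _ hx hy => exact congrArg₂ (· * ·) hx hy
  obtain ⟨φ, hφ⟩ := CommGroup.exists_apply_ne_one_of_hasEnoughRootsOfUnity C ℂ hc
  apply hφ
  have := key (linChar ((Units.coeHom ℂ).comp φ))
  rw [linChar_apply, linChar_apply, map_one] at this
  exact Units.ext this

end Pullback

/-! ### The additivity defect of the `p`-th power. -/

section CrossTerm

/-- The polynomial `((x + y) ^ p - x ^ p - y ^ p) / p`. -/
def crossTerm {R : Type*} [CommRing R] (p : ℕ) (x y : R) : R :=
  ∑ k ∈ Finset.Ioo 0 p, x ^ k * y ^ (p - k) * (p.choose k / p : ℕ)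

theorem add_pow_eq_add_crossTerm {R : Type*} [CommRing R] {p : ℕ} (hp : p.Prime) (x y : R) :
    (x + y) ^ p = x ^ p + y ^ p + p * crossTerm p x y := by
  rw [add_pow_prime_eq hp, crossTerm, Finset.mul_sum, Finset.mul_sum]
  congr 1
  refine Finset.sum_congr rfl fun k hk => ?_
  obtain ⟨hk0, hkp⟩ := Finset.mem_Ioo.1 hk
  rw [← mul_pow_sub_one hk0.ne' x, ← mul_pow_sub_one (Nat.sub_pos_of_lt hkp).ne' y]
  ring

/-- Each monomial has at least one factor `y`, and since `m ≤ n` the worst case is `x ^ (p - 1) y`.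
Replacing `n` by `m + 1` gains one degree over `p * m`, just what well-definedness needs. -/
theorem crossTerm_mem {R : Type*} [CommRing R] (I : Ideal R) {p m n : ℕ} (hmn : m ≤ n) {x y : R}
    (hx : x ∈ I ^ m) (hy : y ∈ I ^ n) : crossTerm p x y ∈ I ^ (m * (p - 1) + n) := by
  refine sum_mem fun k hk => Ideal.mul_mem_right _ _ ?_
  obtain ⟨hk0, hkp⟩ := Finset.mem_Ioo.1 hk
  obtain ⟨d, rfl⟩ := Nat.exists_eq_add_of_lt hkp
  rw [show k + d + 1 - k = d + 1 by omega, Nat.add_sub_cancel]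
  have h := Ideal.mul_mem_mul (Ideal.pow_mem_pow hx k) (Ideal.pow_mem_pow hy (d + 1))
  rw [← pow_mul, ← pow_mul, ← pow_add] at h
  refine Ideal.pow_le_pow_right ?_ h
  have := Nat.mul_le_mul_right d hmn
  rw [mul_add, mul_add, mul_one]
  omega

end CrossTerm

/-! ### The norm from `G` to `G × C` and the augmentation filtration. -/

section Norm

theorem linChar_sub_pow_mem {G C : Type*} [CommGroup G] [CommGroup C] (χ : G →* ℂ) (ψ : C →* ℂ) (j : ℕ) :
    (pullChar (MonoidHom.fst G C) (linChar χ) - pullChar (MonoidHom.snd G C) (linChar ψ) ^ j :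
      VirtualChar (G × C)) ∈ augIdeal (G × C) := by
  rw [mem_augIdeal_iff, AddSubgroupClass.coe_sub, SubmonoidClass.coe_pow, Pi.sub_apply,
    Pi.pow_apply, pullChar_apply, pullChar_apply, linChar_apply, linChar_apply]
  simp

/-- The regular character of `C`, pulled back to `G × C`. -/
noncomputable def regChar (G : Type*) {C : Type*} [Group G] [CommGroup C] (ψ : C →* ℂ) (p : ℕ) :
    VirtualChar (G × C) :=
  ∑ j ∈ Finset.range p, pullChar (MonoidHom.snd G C) (linChar ψ) ^ j

theorem regChar_apply {G C : Type*} [Group G] [CommGroup C] {p : ℕ} {ψ : C →* ℂ} (g : G) (c : C) :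
    (regChar G ψ p : G × C → ℂ) (g, c) = ∑ j ∈ Finset.range p, ψ c ^ j := by
  rw [regChar, AddSubmonoidClass.coe_finsetSum, Finset.sum_apply]
  refine Finset.sum_congr rfl fun j _ => ?_
  rw [SubmonoidClass.coe_pow, Pi.pow_apply, pullChar_apply, linChar_apply]
  rfl

theorem apply_pow_eq_one {C : Type*} [CommGroup C] {p : ℕ} {ψ : C →* ℂ} (hC : Nat.card C = p) (c : C) : ψ c ^ p = 1 := by
  rw [← map_pow, ← hC, pow_card_eq_one', map_one]

variable {G C : Type*} [CommGroup G] [Finite G] [CommGroup C] [Finite C] {p : ℕ}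

/-- The norm from `G` to `G × C`. -/
noncomputable abbrev nm (x : VirtualChar G) : G × C → ℂ :=
  tensorNorm (MonoidHom.inl G C) (inl_injective G C) x

theorem index_range_inl (G C : Type*) [Group G] [Group C] :
    (MonoidHom.inl G C).range.index = Nat.card C := by
  have h : (MonoidHom.inl G C).range = (MonoidHom.snd G C).ker := by
    ext ⟨g, c⟩
    rw [MonoidHom.mem_ker, MonoidHom.coe_snd]
    constructor
    · rintro ⟨h, hh⟩
      exact (congrArg Prod.snd hh).symm
    · rintro rfl
      exact ⟨g, rfl⟩
  rw [h, Subgroup.index_ker, MonoidHom.range_eq_top.2 Prod.snd_surjective, Subgroup.card_top]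

theorem nm_apply_one (hC : Nat.card C = p) (x : VirtualChar G) (g : G) :
    nm x (g, (1 : C)) = (x : G → ℂ) g ^ p := by
  rw [← hC, ← index_range_inl G C]
  exact tensorNorm_of_mem_range _ _ x g

theorem nm_apply_of_ne_one (hp : p.Prime) (hC : Nat.card C = p) (x : VirtualChar G) (g : G) {c : C}
    (hc : c ≠ 1) : nm x (g, c) = (x : G → ℂ) (g ^ p) := by
  have hidx : (MonoidHom.inl G C).range.index = p := (index_range_inl G C).trans hC
  refine tensorNorm_of_notMem_range _ _ (hidx ▸ hp) x ?_ ?_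
  · rintro ⟨h, hh⟩
    exact hc (congrArg Prod.snd hh).symm
  · rw [hidx, Prod.pow_mk, ← hC, pow_card_eq_one']
    rfl

theorem nm_mul (hp : p.Prime) (hC : Nat.card C = p) (x y : VirtualChar G) :
    (nm (x * y) : G × C → ℂ) = nm x * nm y := by
  funext ⟨g, c⟩
  rw [Pi.mul_apply]
  by_cases hc : c = 1
  · subst hc
    simp only [nm_apply_one hC]
    exact mul_pow _ _ _
  · simp only [nm_apply_of_ne_one hp hC _ g hc]
    rfl

theorem nm_linChar (hp : p.Prime) (hC : Nat.card C = p) (χ : G →* ℂ) :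
    (linChar (χ.comp (MonoidHom.fst G C)) ^ p : VirtualChar (G × C)) =
      (nm (linChar χ) : G × C → ℂ) := by
  funext ⟨g, c⟩
  change (linChar (χ.comp (MonoidHom.fst G C)) : G × C → ℂ) (g, c) ^ p = _
  by_cases hc : c = 1
  · subst hc
    simp [nm_apply_one hC, linChar_apply]
  · simp [nm_apply_of_ne_one hp hC _ g hc, linChar_apply]

variable {ψ : C →* ℂ}

/-- At `c = 1` the regular character is `p` and the formula expands `(x + y) ^ p`; at `c ≠ 1` it
vanishes, and `x ↦ x(g ^ p)` is additive. -/
theorem nm_add (hp : p.Prime) (hC : Nat.card C = p) (hψ : ∀ c ≠ 1, ψ c ≠ 1) (x y : VirtualChar G) :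
    (nm (x + y) : G × C → ℂ) = nm x + nm y +
      ((regChar G ψ p * pullChar (MonoidHom.fst G C) (crossTerm p x y) : VirtualChar (G × C)) :
        G × C → ℂ) := by
  funext ⟨g, c⟩
  rw [Pi.add_apply, Pi.add_apply, Subring.coe_mul, Pi.mul_apply, regChar_apply]
  by_cases hc : c = 1
  · subst hc
    simp only [nm_apply_one hC]
    have h := congrArg (fun z : VirtualChar G => (z : G → ℂ) g) (add_pow_eq_add_crossTerm hp x y)
    rw [map_one]
    simp only [one_pow, Finset.sum_const, Finset.card_range, nsmul_eq_mul, mul_one]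
    exact h
  · simp only [nm_apply_of_ne_one hp hC _ g hc]
    have h := mul_neg_geom_sum (ψ c) p
    rw [apply_pow_eq_one hC, sub_self, mul_eq_zero, sub_eq_zero] at h
    rw [h.resolve_left fun h' => hψ c hc h'.symm, zero_mul, add_zero]
    rfl

/-- At `c = 1` both sides are `(χ - 1) ^ p`; at `c ≠ 1` the value `ψ(c)` is a primitive `p`-th root
of unity and the product is `χ ^ p - 1`. -/
theorem nm_linChar_sub_one (hp : p.Prime) (hC : Nat.card C = p) (hψ : ∀ c ≠ 1, ψ c ≠ 1)
    (χ : G →* ℂ) :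
    (∏ j ∈ Finset.range p, (pullChar (MonoidHom.fst G C) (linChar χ) -
      pullChar (MonoidHom.snd G C) (linChar ψ) ^ j) : VirtualChar (G × C)) =
      (nm (linChar χ - 1) : G × C → ℂ) := by
  funext ⟨g, c⟩
  have h1 : ((∏ j ∈ Finset.range p, (pullChar (MonoidHom.fst G C) (linChar χ) -
      pullChar (MonoidHom.snd G C) (linChar ψ) ^ j) : VirtualChar (G × C)) : G × C → ℂ) (g, c) =
      ∏ j ∈ Finset.range p, (χ g - ψ c ^ j) := by
    rw [SubmonoidClass.coe_finsetProd, Finset.prod_apply]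
    refine Finset.prod_congr rfl fun j _ => ?_
    rw [AddSubgroupClass.coe_sub, SubmonoidClass.coe_pow, Pi.sub_apply, Pi.pow_apply,
      pullChar_apply, pullChar_apply, linChar_apply, linChar_apply]
    rfl
  have h2 : ∀ g, ((linChar χ - 1 : VirtualChar G) : G → ℂ) g = χ g - 1 := fun g => by
    rw [← linChar_apply χ]; rfl
  rw [h1]
  by_cases hc : c = 1
  · subst hc
    simp [nm_apply_one hC, h2]
  · rw [nm_apply_of_ne_one hp hC _ g hc, h2, map_pow]
    have := Fact.mk hp
    have hprim : IsPrimitiveRoot (ψ c) p := by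
      rw [← orderOf_eq_prime (apply_pow_eq_one hC c) (hψ c hc)]
      exact IsPrimitiveRoot.orderOf _
    have h := congrArg (Polynomial.eval (χ g))
      (X_pow_sub_C_eq_prod hprim hp.pos (one_pow p : (1 : ℂ) ^ p = 1))
    rw [Polynomial.eval_prod] at h
    simpa using h.symm

theorem mul_pred_add {n p : ℕ} (hp : p.Prime) : n * (p - 1) + n = p * n := by
  obtain ⟨q, rfl⟩ := Nat.exists_eq_add_of_lt hp.pos
  simp
  ring

/-- The norm maps the `n`-th power of the augmentation ideal to the `pn`-th one. -/
theorem exists_nm_eq (hp : p.Prime) (hC : Nat.card C = p) (hψ : ∀ c ≠ 1, ψ c ≠ 1) {n : ℕ}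
    {x : VirtualChar G} (hx : x ∈ augIdeal G ^ n) :
    ∃ y ∈ augIdeal (G × C) ^ (p * n), (y : G × C → ℂ) = nm x := by
  have hcross : ∀ {m : ℕ} {a b : VirtualChar G}, a ∈ augIdeal G ^ m → b ∈ augIdeal G ^ m →
      regChar G ψ p * pullChar (MonoidHom.fst G C) (crossTerm p a b) ∈
        augIdeal (G × C) ^ (p * m) := fun {m a b} ha hb =>
    Ideal.mul_mem_left _ _ (mul_pred_add (n := m) hp ▸ pullChar_mem _ (crossTerm_mem _ le_rfl ha hb))
  -- Membership is part of `P` because bounding the cross term of two elements requires it of both.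
  let P (m : ℕ) (a : VirtualChar G) : Prop := a ∈ augIdeal G ^ m ∧
    ∃ y ∈ augIdeal (G × C) ^ (p * m), (y : G × C → ℂ) = nm a
  have hadd : ∀ m a b, P m a → P m b → P m (a + b) := by
    rintro m a b ⟨ha, y, hy, hya⟩ ⟨hb, z, hz, hzb⟩
    refine ⟨add_mem ha hb, _, add_mem (add_mem hy hz) (hcross ha hb), ?_⟩
    rw [nm_add hp hC hψ, ← hya, ← hzb]
    rfl
  have hsub : ∀ m a b, P m a → P m b → P m (a - b) := by
    rintro m a b ⟨ha, y, hy, hya⟩ ⟨hb, z, hz, hzb⟩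
    refine ⟨sub_mem ha hb, _, sub_mem (sub_mem hy hz) (hcross (sub_mem ha hb) hb), ?_⟩
    -- `N` is not odd in general, so `N(a - b)` is obtained by solving the addition formula for `a =
    -- (a - b) + b`.
    have h := nm_add (ψ := ψ) hp hC hψ (a - b) b
    rw [sub_add_cancel, ← hya, ← hzb] at h
    rw [AddSubgroupClass.coe_sub, AddSubgroupClass.coe_sub, h]
    ring
  have hone : ∀ a ∈ augIdeal G, P 1 a := fun a ha => by
    refine augIdeal_induction (P := P 1) (fun χ => ⟨?_, _, ?_, nm_linChar_sub_one hp hC hψ χ⟩)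
      (hsub 1) ha
    · rw [pow_one]; exact linChar_sub_one_mem χ
    · have := Ideal.prod_mem_prod (s := Finset.range p) (I := fun _ => augIdeal (G × C))
        fun j _ => linChar_sub_pow_mem χ ψ j
      simpa using this
  suffices h : P n x from h.2
  induction n generalizing x with
  | zero =>
    exact linChar_induction (P := P 0)
      (fun χ => ⟨by simp, _, by simp, nm_linChar hp hC χ⟩) (hsub 0) x
  | succ n ih =>
    rw [pow_succ] at hx
    refine Submodule.mul_induction_on hx (fun a ha b hb => ?_) (hadd (n + 1))
    obtain ⟨ha', y, hy, hya⟩ := ih ha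
    obtain ⟨hb', z, hz, hzb⟩ := hone b hb
    refine ⟨pow_succ (augIdeal G) n ▸ Ideal.mul_mem_mul ha hb, y * z, ?_, ?_⟩
    · rw [mul_add, pow_add]
      exact Ideal.mul_mem_mul hy hz
    · rw [nm_mul hp hC, ← hya, ← hzb]
      rfl

/-- By the addition formula `N(b) - N(a)` is `N(b - a)`, of degree `p * (n + 1)`, plus a cross term
of degree `p * n + 1`. -/
theorem nm_sub_mem (hp : p.Prime) (hC : Nat.card C = p) (hψ : ∀ c ≠ 1, ψ c ≠ 1) {n : ℕ}
    {a b : VirtualChar G} (ha : a ∈ augIdeal G ^ n) (hab : -a + b ∈ augIdeal G ^ (n + 1))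
    {y z : VirtualChar (G × C)} (hy : (y : G × C → ℂ) = nm a) (hz : (z : G × C → ℂ) = nm b) :
    -y + z ∈ augIdeal (G × C) ^ (p * n + 1) := by
  obtain ⟨w, hw, hwab⟩ := exists_nm_eq hp hC hψ hab
  have h := nm_add hp hC hψ a (-a + b)
  rw [add_neg_cancel_left, ← hy, ← hz, ← hwab] at h
  have h' : -y + z = w + regChar G ψ p * pullChar (MonoidHom.fst G C) (crossTerm p a (-a + b)) := by
    rw [neg_add_eq_iff_eq_add, ← add_assoc]
    exact Subtype.ext h
  rw [h']
  refine add_mem (Ideal.pow_le_pow_right ?_ hw) (Ideal.mul_mem_left _ _ ?_)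
  · rw [mul_add, mul_one]
    exact Nat.add_le_add_left hp.one_lt.le _
  · have := pullChar_mem (MonoidHom.fst G C) (crossTerm_mem (p := p) _ n.le_succ ha hab)
    rwa [Nat.succ_eq_add_one, ← add_assoc, mul_pred_add hp] at this

end Norm
-- Products in the graded ring and the final computation.
section Graded

variable {G : Type*} [Group G]

theorem of_grMk_mul {m n : ℕ} (a : Gam G m) (b : Gam G n) :
    (DirectSum.of (Gr G) m (grMk m a) * DirectSum.of (Gr G) n (grMk n b) : GradedCharRing G) =
      DirectSum.of (Gr G) (m + n) (grMk (m + n) (gamMul m n a b)) :=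
  DirectSum.of_mul_of _ _

theorem of_grMk_eq {m n : ℕ} (hmn : m = n) {a : Gam G m} {b : Gam G n}
    (hab : (a : VirtualChar G) = b) :
    DirectSum.of (Gr G) m (grMk m a) = DirectSum.of (Gr G) n (grMk n b) := by
  subst hmn
  rw [Subtype.ext hab]

theorem exists_prod_of_grMk (a : ℕ → Gam G 1) (s : ℕ) : ∃ b : Gam G s,
    (b : VirtualChar G) = ∏ j ∈ Finset.range s, (a j : VirtualChar G) ∧
      ∏ j ∈ Finset.range s, DirectSum.of (Gr G) 1 (grMk 1 (a j)) =
        (DirectSum.of (Gr G) s (grMk s b) : GradedCharRing G) := by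
  induction s with
  | zero => exact ⟨⟨1, one_mem_Gam G⟩, by simp, rfl⟩
  | succ s ih =>
    obtain ⟨b, hb, h⟩ := ih
    refine ⟨gamMul s 1 b (a s), ?_, ?_⟩
    · rw [Finset.prod_range_succ, ← hb]
      rfl
    · rw [Finset.prod_range_succ, h, of_grMk_mul]

end Graded

/-- First-order expansion of `r ^ j` at `1`; in the graded ring it says that `c₁` of a `j`-th power
is `j` times `c₁`. -/
theorem pow_sub_one_sub_mem {R : Type*} [CommRing R] (I : Ideal R) {r : R} (hr : r - 1 ∈ I)
    (j : ℕ) : r ^ j - 1 - j * (r - 1) ∈ I ^ 2 := by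
  induction j with
  | zero => simp
  | succ j ih =>
    have h1 : r ^ j - 1 ∈ I := Ideal.mem_of_dvd I (sub_one_dvd_pow_sub_one r j) hr
    have h2 := add_mem ih (pow_two I ▸ Ideal.mul_mem_mul h1 hr)
    convert h2 using 1
    push_cast
    ring

variable {G C : Type*} [CommGroup G] [Finite G] [CommGroup C] [Finite C] {p : ℕ} {ψ : C →* ℂ}

theorem coe_chernLift_one {G : Type*} [CommGroup G] [Finite G] {V : FDRep ℂ G}
    (hV : Module.finrank ℂ V = 1) : (chernLift 1 V : VirtualChar G) = ofRep V - 1 := by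
  change gammaOp 1 _ = _
  rw [gammaOp_one, hV, Nat.cast_one]

/-- The graded norm exists. -/
theorem exists_isGradedNorm (hp : p.Prime) (hC : Nat.card C = p) (hψ : ∀ c ≠ 1, ψ c ≠ 1) :
    ∃ N : (n : ℕ) → Gr G n → Gr (G × C) ((MonoidHom.inl G C).range.index * n),
      ∀ n, IsGradedNorm (MonoidHom.inl G C) (inl_injective G C) n (N n) := by
  have hidx : (MonoidHom.inl G C).range.index = p := (index_range_inl G C).trans hC
  have key : ∀ (n : ℕ) (X : Gam G n), ∃ Y : Gam (G × C) ((MonoidHom.inl G C).range.index * n),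
      ((Y : VirtualChar (G × C)) : G × C → ℂ) = nm (X : VirtualChar G) := by
    intro n X
    obtain ⟨y, hy, hyX⟩ := exists_nm_eq hp hC hψ (mem_Gam_iff.1 X.2)
    exact ⟨⟨y, mem_Gam_iff.2 (hidx.symm ▸ hy)⟩, hyX⟩
  choose F hF using key
  refine ⟨fun n => Quotient.map (F n) ?_, fun n X => ⟨F n X, hF n X, rfl⟩⟩
  intro a b hab
  have hab' : (-a + b : VirtualChar G) ∈ Gam G (n + 1) := grMk_eq_iff.1 (Quotient.sound hab)
  refine Quotient.exact (grMk_eq_iff.2 (mem_Gam_iff.2 ?_))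
  have h := nm_sub_mem hp hC hψ (mem_Gam_iff.1 a.2) (mem_Gam_iff.1 hab') (hF n a) (hF n b)
  exact Ideal.pow_le_pow_right (by rw [hidx]) h

/-- The class of `∏_{j < p} (σ - ρ ^ j)` is `z ^ p - z y ^ (p - 1)`. -/
theorem of_grMk_eq_pow_sub {K : Type*} [CommGroup K] [Finite K] {p m : ℕ} (hp : p.Prime)
    (hm : m = p) {s r : VirtualChar K} (hs : s - 1 ∈ augIdeal K) (hr : r - 1 ∈ augIdeal K)
    (hrp : r ^ p = 1) {Y : Gam K m} (hY : (Y : VirtualChar K) = ∏ j ∈ Finset.range p, (s - r ^ j))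
    {Z W : Gam K 1} (hZ : (Z : VirtualChar K) = s - 1) (hW : (W : VirtualChar K) = r - 1) :
    (DirectSum.of (Gr K) m (grMk m Y) : GradedCharRing K) =
      DirectSum.of (Gr K) 1 (grMk 1 Z) ^ p -
        DirectSum.of (Gr K) 1 (grMk 1 Z) * DirectSum.of (Gr K) 1 (grMk 1 W) ^ (p - 1) := by
  have hmem : ∀ j : ℕ, s - r ^ j ∈ Gam K 1 := fun j => by
    have h1 : r ^ j - 1 ∈ augIdeal K := Ideal.mem_of_dvd _ (sub_one_dvd_pow_sub_one r j) hr
    have := sub_mem hs h1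
    rw [sub_sub_sub_cancel_right] at this
    exact augIdeal_le_Gam_one this
  have hlin : ∀ j : ℕ, (DirectSum.of (Gr K) 1 (grMk 1 ⟨_, hmem j⟩) : GradedCharRing K) =
      DirectSum.of (Gr K) 1 (grMk 1 Z) - j * DirectSum.of (Gr K) 1 (grMk 1 W) := by
    intro j
    rw [← nsmul_eq_mul, ← map_nsmul, ← map_nsmul, ← map_sub, ← map_sub]
    congr 1
    rw [grMk_eq_iff, mem_Gam_iff]
    convert pow_sub_one_sub_mem _ hr j using 1
    push_cast
    rw [hZ, hW, nsmul_eq_mul]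
    ring
  -- Since `r ^ p = r ^ 0`, comparing the linear formula at `j = 0` and `j = p` gives the torsion
  -- relation.
  have hp0 : (p : GradedCharRing K) * DirectSum.of (Gr K) 1 (grMk 1 W) = 0 := by
    have h0 := hlin 0
    have h1 := hlin p
    simp only [hrp, pow_zero] at h0 h1
    rw [h0] at h1
    simpa [sub_eq_self, eq_comm (a := DirectSum.of (Gr K) 1 (grMk 1 Z))] using h1
  rw [← prod_sub_nsmul_eq hp _ _ hp0]
  simp_rw [← hlin]
  obtain ⟨b, hb, h⟩ := exists_prod_of_grMk (fun j => (⟨_, hmem j⟩ : Gam K 1)) p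
  rw [h]
  exact of_grMk_eq hm (hY.trans hb.symm)

end CharRing

open CharRing in
theorem mainTheorem12 {G C : Type*} [CommGroup G] [Finite G] [CommGroup C] [Finite C]
    (p : ℕ) (hp : p.Prime) (hC : Nat.card C = p)
    (σ : FDRep ℂ G) (hσ : Module.finrank ℂ σ = 1)
    (ρ : FDRep ℂ C) (hρ : Module.finrank ℂ ρ = 1)
    (hgen : Subring.closure {CharRing.ofRep ρ} = ⊤)
    (y z : CharRing.GradedCharRing (G × C))
    (hy : y = CharRing.chern 1 (CharRing.pullback (MonoidHom.snd G C) ρ))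
    (hz : z = CharRing.chern 1 (CharRing.pullback (MonoidHom.fst G C) σ)) :
    ∃ N : (n : ℕ) → CharRing.Gr G n →
        CharRing.Gr (G × C) ((MonoidHom.inl G C).range.index * n),
      (∀ n, CharRing.IsGradedNorm (MonoidHom.inl G C) (CharRing.inl_injective G C) n (N n)) ∧
      DirectSum.of (CharRing.Gr (G × C)) _ (N 1 (CharRing.chernGr 1 σ)) =
        z ^ p - z * y ^ (p - 1) := by
  obtain ⟨χ, hχ⟩ := exists_ofRep_eq_linChar hσ
  obtain ⟨ψ, hρψ⟩ := exists_ofRep_eq_linChar hρ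
  rw [hρψ] at hgen
  have hψ : ∀ c ≠ 1, ψ c ≠ 1 := fun c hc => apply_ne_one_of_closure_eq_top hgen hc
  obtain ⟨N, hN⟩ := exists_isGradedNorm (G := G) hp hC hψ
  refine ⟨N, hN, ?_⟩
  obtain ⟨Y, hY, hNY⟩ := hN 1 (chernLift 1 σ)
  rw [hy, hz, chern, chern, chernGr, chernGr, chernGr, hNY]
  refine of_grMk_eq_pow_sub hp ((mul_one _).trans ((index_range_inl G C).trans hC))
    (s := pullChar (MonoidHom.fst G C) (linChar χ)) (r := pullChar (MonoidHom.snd G C) (linChar ψ))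
    ?_ ?_ ?_ ?_ ?_ ?_
  · exact linChar_sub_one_mem (χ.comp (MonoidHom.fst G C))
  · exact linChar_sub_one_mem (ψ.comp (MonoidHom.snd G C))
  · apply Subtype.ext
    funext ⟨g, c⟩
    change (linChar ψ : C → ℂ) c ^ p = 1
    rw [linChar_apply, apply_pow_eq_one hC]
  · rw [coe_chernLift_one hσ, hχ] at hY
    exact Subtype.ext (hY.trans (nm_linChar_sub_one hp hC hψ χ).symm)
  · exact (coe_chernLift_one (G := G × C) hσ).trans (by rw [ofRep_pullback, hχ])
  · exact (coe_chernLift_one (G := G × C) hρ).trans (by rw [ofRep_pullback, hρψ])
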